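/- Fix a smooth function $\varphi:\mathbb R\to\mathbb C$ with support in $[1/2,2]$, a smooth $\psi:\mathbb R\to\mathbb C$ with support in $[1/2,2]$, and a smooth function $\psi_1:[0,\infty)\to\mathbb C$ with support in $[0,3/4]$, such that $$\sum_{j\ge 2}\psi\big(2^j(1-t)\big)+\psi_1(t)=1,\qquad 0\le t<1 .$$ For $\lambda>0$ and $\xi,\eta\in\mathbb R^2$ put $$m^\lambda(\xi,\eta)=\Big(1-\frac{\xi_1^2}{\xi_2^2}-\frac{\eta_1^2}{\eta_2^2}\Big)_+^\lambda\varphi(\xi_2)\varphi(\eta_2),$$ $$m_1^\lambda(\xi,\eta)=\psi_1\Big(\frac{\xi_1^2}{\xi_2^2}\Big)m^\lambda(\xi,\eta),\qquad m_j^\lambda(\xi,\eta)=\psi\Big(2^j\Big(1-\frac{\xi_1^2}{\xi_2^2}\Big)\Big)m^\lambda(\xi,\eta)\quad(j\ge2)$$ (read as $0$ where $\xi_2=0$ or $\eta_2=0$), and let $\mathcal C_j^\lambda$ be the bilinear multiplier operator associated with $m_j^\lambda$: $$\mathcal C_j^\lambda(f,g)(x)=\int_{\mathbb R^4}m_j^\lambda(\xi,\eta)\,\widehat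 f(\xi)\,\widehat g(\eta)\,e^{2\pi i x\cdot(\xi+\eta)}\,d\xi\,d\eta$$ for $f,g\in L^1(\mathbb R^2)$ (in particular for Schwartz functions), and in general $$\mathcal C_j^\lambda(f,g)(x)=\int_{\mathbb R^4}K_j(x-y,x-z)f(y)g(z)\,dy\,dz,\qquad K_j(y,z)=\int_{\mathbb R^4}m_j^\lambda(\xi,\eta)e^{2\pi i(y\cdot\xi+z\cdot\eta)}\,d\xi\,d\eta .$$ **Proposition.** Let $1<p_1,p_2\le\infty$ and $1\le p\le\infty$ satisfy $\frac1p=\frac1{p_1}+\frac1{p_2}$, and let $\lambda>1$. For every $j\ge1$ the two formulas for $\mathcal C_j^\lambda(f,g)$ agree when $f,g\in L^1(\mathbb R^2)$. Moreover there are $\varepsilon>0$ and $C>0$, independent of $j,f,g$, such that for all $j\ge1$, $f\in L^{p_1}(\mathbb R^2)$ and $g\in L^{p_2}(\mathbb R^2)$ the integral defining $\mathcal C_j^\lambda(f,g)(x)$ through $K_j$ converges absolutely for almost every $x$, $\mathcal C_j^\lambda(f,g)\in L^p(\mathbb R^2)$, and $$\|\mathcal C_j^\lambda(f,g)\|_{L^p}\le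 C\,2^{-\varepsilon j}\|f\|_{L^{p_1}}\|g\|_{L^{p_2}} .$$ -/

import Mathlib

open MeasureTheory Set
open scoped ENNReal FourierTransform ContDiff

noncomputable section

/-- The plane `ℝ²` with its Euclidean structure; the coordinates `ξ₁, ξ₂` are `ξ 0, ξ 1`. -/
abbrev Plane : Type := EuclideanSpace ℝ (Fin 2)

/-- Smooth functions on `ℝ` supported in `[1/2, 2]`. -/
def IsDyadicBump (φ : ℝ → ℂ) : Prop :=
  ContDiff ℝ ∞ φ ∧ tsupport φ ⊆ Icc (1 / 2) 2

/-- The pair `ψ, ψ₁` of the dyadic decomposition: `ψ` is smooth and supported in `[1/2, 2]`,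
`ψ₁` is a smooth function on the half-line `[0, ∞)` supported in `[0, 3/4]` (its values at negative
arguments are never used), and `∑_{j ≥ 2} ψ (2 ^ j (1 - t)) + ψ₁ t = 1` for `0 ≤ t < 1`. -/
structure IsDyadicPartition (ψ ψ₁ : ℝ → ℂ) : Prop where
  bump : IsDyadicBump ψ
  smooth_one : ContDiffOn ℝ ∞ ψ₁ (Ici 0)
  support_one : ∀ t : ℝ, 3 / 4 < t → ψ₁ t = 0
  hasSum : ∀ t : ℝ, 0 ≤ t → t < 1 →
    HasSum (fun k : ℕ ↦ ψ (2 ^ (k + 2) * (1 - t))) (1 - ψ₁ t)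

/-- The regularized bilinear cone multiplier
`m^lam (ξ, η) = (1 - ξ₁² / ξ₂² - η₁² / η₂²)₊ ^ lam φ(ξ₂) φ(η₂)`. -/
def coneMultiplier (lam : ℝ) (φ : ℝ → ℂ) (ξ η : Plane) : ℂ :=
  ((max (1 - ξ 0 ^ 2 / ξ 1 ^ 2 - η 0 ^ 2 / η 1 ^ 2) 0 ^ lam : ℝ) : ℂ) * φ (ξ 1) * φ (η 1)

/-- The `j`-th dyadic piece `m_j^lam` of the bilinear cone multiplier, `j ≥ 1`. -/
def conePiece (lam : ℝ) (φ ψ ψ₁ : ℝ → ℂ) (j : ℕ) (ξ η : Plane) : ℂ :=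
  (if j = 1 then ψ₁ (ξ 0 ^ 2 / ξ 1 ^ 2) else ψ (2 ^ j * (1 - ξ 0 ^ 2 / ξ 1 ^ 2))) *
    coneMultiplier lam φ ξ η

/-- The bilinear multiplier formula on the Fourier side,
`∫_{ℝ⁴} m(ξ, η) f̂(ξ) ĝ(η) e^{2πi x·(ξ+η)} dξ dη`, for integrable `f, g` (e.g. Schwartz). -/
def bilinearFourierOp (m : Plane → Plane → ℂ) (f g : Plane → ℂ) (x : Plane) : ℂ :=
  ∫ ζ : Plane × Plane, m ζ.1 ζ.2 * 𝓕 f ζ.1 * 𝓕 g ζ.2 *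
    Complex.exp (2 * Real.pi * Complex.I * (inner ℝ x (ζ.1 + ζ.2) : ℝ))

/-- The kernel `K(y, z) = ∫_{ℝ⁴} m(ξ, η) e^{2πi (y·ξ + z·η)} dξ dη` of a bilinear multiplier. -/
def bilinearKernel (m : Plane → Plane → ℂ) (y z : Plane) : ℂ :=
  ∫ ζ : Plane × Plane, m ζ.1 ζ.2 *
    Complex.exp (2 * Real.pi * Complex.I * (inner ℝ y ζ.1 + inner ℝ z ζ.2 : ℝ))

/-- The integrand `(y, z) ↦ K(x - y, x - z) f(y) g(z)`. -/
def bilinearIntegrand (m : Plane → Plane → ℂ) (f g : Plane → ℂ) (x : Plane) (w : Plane × Plane) :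
    ℂ :=
  bilinearKernel m (x - w.1) (x - w.2) * f w.1 * g w.2

/-- The bilinear multiplier operator associated with `m`, for functions `f, g` whose Fourier
transforms need not be functions: `∫_{ℝ⁴} K(x - y, x - z) f(y) g(z) dy dz`. -/
def bilinearOp (m : Plane → Plane → ℂ) (f g : Plane → ℂ) (x : Plane) : ℂ :=
  ∫ w : Plane × Plane, bilinearIntegrand m f g x w

end

/-!
The multiplier of `𝓒_j` depends on `ξ` and `η` only through the slopes `u = ξ₁ / ξ₂`, `v = η₁ / η₂`,
apart from the cutoffs in `ξ₂` and `η₂`. The whole statement follows from the bound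
`‖K_j‖_{L¹(ℝ⁴)} ≤ C 2 ^ (-j (lam - 1) / 2)` for its kernel: Young's inequality for bilinear
convolutions (`bilinearOp_bound_of_kernel`) turns it into the `L^{p₁} × L^{p₂} → L^p` bound, and the
Fourier formula is Fubini's theorem (`bilinearOp_eq_bilinearFourierOp`).

Integrating in `ξ₂, η₂` before the slopes gives (`bilinearKernel_slope`)
`K(y, z) = ∫∫ M(u, v) Φ(y₂ + u y₁) Φ(z₂ + v z₁) du dv`, where `Φ` is the inverse Fourier transform
of `|b| φ(b)`. Since `φ` vanishes near `0`, the profile `Φ` is the second derivative of a Schwartz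
function (`IsDyadicBump.exists_profile`), so two integrations by parts in `u` gain `y₁⁻²`, and the
same holds in `v`. Together with the trivial bound this yields (`lintegral_slope_average_tensor_le`),
for every `δ > 0`,
`‖K‖₁ ≲ δ⁻² (‖M‖₁ + δ² ‖∂ᵤ²M‖₁ + δ² ‖∂ᵥ²M‖₁ + δ⁴ ‖∂ᵤ²∂ᵥ²M‖₁)`.
In other words, one derivative in each slope has to be controlled in `L¹`, and
`∂ᵤ∂ᵥ (1 - u² - v²)₊ ^ lam` is integrable, with room to spare, because `lam > 1`.

To use the room, `M(u, v) = Ψ(u) (1 - u² - v²)₊ ^ lam` is cut into pieces living where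
`1 - u² - v²` is comparable to `δ = 2 ^ (-n)` (`exists_dyadic_rpow`). Such a piece has size
`δ ^ lam`, its support has area `O(δ)`, and every derivative costs `δ⁻¹`, so that its kernel has
`L¹` norm `O(δ ^ (lam - 1))` (`IsSlopeCutoff.lintegral_piece_le`). The cutoff `Ψ` of the `j`-th
multiplier varies at the scale `2 ^ (-j)` and is supported where `1 - u² ≤ 2 ^ (1 - j)`; hence only
`δ ≤ 4 · 2 ^ (-j)` contributes. This makes the derivatives of `Ψ` harmless and gives the decay
in `j`.
-/

open scoped SchwartzMap

/-! ### Bilinear operators with integrable kernel -/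

/-- Minkowski's integral inequality for a family of functions with a common `L^p` bound. -/
theorem eLpNorm_lintegral_le_of_forall_le {α β : Type*} [MeasurableSpace α] [MeasurableSpace β]
    {μ : Measure α} {ν : Measure β} [SFinite μ] [SFinite ν] {p : ℝ≥0∞} (hp : 1 ≤ p)
    {F : α → β → ℝ≥0∞} (hF : Measurable (Function.uncurry F)) {B : ℝ≥0∞}
    (hB : ∀ w, eLpNorm (fun x ↦ F x w) p μ ≤ B) (hν : ν univ ≠ ⊤) :
    eLpNorm (fun x ↦ ∫⁻ w, F x w ∂ν) p μ ≤ ν univ * B := by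
  rcases eq_or_ne p ⊤ with rfl | hp'
  · have h1 : ∀ᵐ x ∂μ, ∀ᵐ w ∂ν, F x w ≤ B := by
      rw [Measure.ae_ae_comm (p := fun x w ↦ F x w ≤ B) (measurableSet_le hF measurable_const)]
      refine Filter.Eventually.of_forall fun w ↦ ?_
      have h := hB w
      rw [eLpNorm_exponent_top] at h
      have h2 := enorm_ae_le_eLpNormEssSup (fun x ↦ F x w) μ
      filter_upwards [h2] with x hx
      exact (by simpa using hx : F x w ≤ _).trans h
    rw [eLpNorm_exponent_top]
    refine eLpNormEssSup_le_of_ae_enorm_bound ?_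
    filter_upwards [h1] with x hx
    rw [enorm_eq_self, mul_comm, ← lintegral_const]
    exact lintegral_mono_ae hx
  · have hp0 : p ≠ 0 := (zero_lt_one.trans_le hp).ne'
    have hr : 1 ≤ p.toReal := by
      rwa [← ENNReal.toReal_one, ENNReal.toReal_le_toReal ENNReal.one_ne_top hp']
    have hr0 : 0 < p.toReal := by linarith
    set r := p.toReal with hrdef
    have hpow : ∀ w, ∫⁻ x, F x w ^ r ∂μ ≤ B ^ r := by
      intro w
      have h := hB w
      rw [eLpNorm_eq_lintegral_rpow_enorm_toReal hp0 hp'] at h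
      have := ENNReal.rpow_le_rpow h hr0.le
      rw [← ENNReal.rpow_mul, one_div, inv_mul_cancel₀ hr0.ne', ENNReal.rpow_one] at this
      simpa using this
    have hx : ∀ x, (∫⁻ w, F x w ∂ν) ^ r ≤ (∫⁻ w, F x w ^ r ∂ν) * ν univ ^ (r - 1) := by
      intro x
      have hm : Measurable (F x) := hF.comp measurable_prodMk_left
      have h := eLpNorm_le_eLpNorm_mul_rpow_measure_univ (μ := ν) hp hm.aestronglyMeasurable
      rw [eLpNorm_one_eq_lintegral_enorm, eLpNorm_eq_lintegral_rpow_enorm_toReal hp0 hp'] at h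
      simp only [enorm_eq_self, ENNReal.toReal_one] at h
      have h2 := ENNReal.rpow_le_rpow h hr0.le
      rw [ENNReal.mul_rpow_of_nonneg _ _ hr0.le, ← ENNReal.rpow_mul, ← ENNReal.rpow_mul, ← hrdef,
        one_div, inv_mul_cancel₀ hr0.ne', ENNReal.rpow_one] at h2
      refine h2.trans_eq ?_
      congr 2
      field_simp
    rw [eLpNorm_eq_lintegral_rpow_enorm_toReal hp0 hp']
    simp only [enorm_eq_self]
    have hmain : ∫⁻ x, (∫⁻ w, F x w ∂ν) ^ r ∂μ ≤ (ν univ * B) ^ r := by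
      calc ∫⁻ x, (∫⁻ w, F x w ∂ν) ^ r ∂μ
          ≤ ∫⁻ x, (∫⁻ w, F x w ^ r ∂ν) * ν univ ^ (r - 1) ∂μ := lintegral_mono hx
        _ = (∫⁻ w, ∫⁻ x, F x w ^ r ∂μ ∂ν) * ν univ ^ (r - 1) := by
          rw [lintegral_mul_const' _ _ (ENNReal.rpow_ne_top_of_nonneg (by linarith) hν),
            lintegral_lintegral_swap]
          exact (hF.pow_const r).aemeasurable
        _ ≤ (∫⁻ _, B ^ r ∂ν) * ν univ ^ (r - 1) := by
          gcongr with w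
          exact hpow w
        _ = (ν univ * B) ^ r := by
          rw [lintegral_const, ENNReal.mul_rpow_of_nonneg _ _ hr0.le, mul_assoc, mul_comm]
          congr 1
          rcases eq_or_ne (ν univ) 0 with h0 | h0
          · simp [h0, hr0]
          · nth_rewrite 1 [← ENNReal.rpow_one (ν univ)]
            rw [← ENNReal.rpow_add _ _ h0 hν]
            congr 1
            ring
    calc _ ≤ ((ν univ * B) ^ r) ^ (1 / r) := ENNReal.rpow_le_rpow hmain (by positivity)
      _ = ν univ * B := by
        rw [← ENNReal.rpow_mul, mul_one_div, div_self hr0.ne', ENNReal.rpow_one]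

theorem ae_lt_top_of_eLpNorm_lt_top {α : Type*} [MeasurableSpace α] {μ : Measure α} {p : ℝ≥0∞}
    (hp : p ≠ 0) {H : α → ℝ≥0∞} (hH : Measurable H) (h : eLpNorm H p μ < ⊤) :
    ∀ᵐ x ∂μ, H x < ⊤ := by
  rcases eq_or_ne p ⊤ with rfl | hp'
  · rw [eLpNorm_exponent_top] at h
    filter_upwards [enorm_ae_le_eLpNormEssSup H μ] with x hx
    exact (by simpa using hx : H x ≤ _).trans_lt h
  · have hr : 0 < p.toReal := ENNReal.toReal_pos hp hp'
    rw [eLpNorm_eq_lintegral_rpow_enorm_toReal hp hp', one_div,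
      ENNReal.rpow_lt_top_iff_of_pos (by positivity)] at h
    filter_upwards [ae_lt_top (by fun_prop) h.ne] with x hx
    simpa using (ENNReal.rpow_lt_top_iff_of_pos hr).1 hx

section Convolution

theorem bilinear_reflection_measurePreserving (x : Plane) :
    MeasurePreserving (fun w : Plane × Plane ↦ (x - w.1, x - w.2)) volume volume :=
  (Measure.measurePreserving_sub_left volume x).prod (Measure.measurePreserving_sub_left volume x)

variable {k : Plane × Plane → ℂ} {p₁ p₂ p : ℝ≥0∞} {f g : Plane → ℂ}

theorem measurable_bilinear_integrand (hk : Measurable k) (hf : Measurable f) (hg : Measurable g) :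
    Measurable (fun z : Plane × (Plane × Plane) ↦
      k (z.1 - z.2.1, z.1 - z.2.2) * f z.2.1 * g z.2.2) := by
  fun_prop

/-- Young's inequality for bilinear convolutions: an integrable kernel on `ℝ⁴` maps
`L^{p₁} × L^{p₂}` to `L^p`, even after absolute values are taken inside. -/
theorem eLpNorm_lintegral_bilinear_le (hk : Measurable k) (hk1 : ∫⁻ w, ‖k w‖ₑ ≠ ⊤)
    (hp : 1 ≤ p) (hpp : p⁻¹ = p₁⁻¹ + p₂⁻¹) (hf : Measurable f) (hg : Measurable g) :
    eLpNorm (fun x ↦ ∫⁻ w : Plane × Plane, ‖k (x - w.1, x - w.2) * f w.1 * g w.2‖ₑ) p volume ≤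
      (∫⁻ w, ‖k w‖ₑ) * (eLpNorm f p₁ volume * eLpNorm g p₂ volume) := by
  have hrw : ∀ x : Plane, ∫⁻ w : Plane × Plane, ‖k (x - w.1, x - w.2) * f w.1 * g w.2‖ₑ =
      ∫⁻ w, ‖f (x - w.1) * g (x - w.2)‖ₑ ∂(volume.withDensity fun w ↦ ‖k w‖ₑ) := by
    intro x
    rw [lintegral_withDensity_eq_lintegral_mul _ hk.enorm (by fun_prop),
      ← (bilinear_reflection_measurePreserving x).lintegral_comp (by fun_prop)]
    simp [enorm_mul, mul_assoc]
  simp_rw [hrw]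
  have hu : (volume.withDensity fun w ↦ ‖k w‖ₑ) univ = ∫⁻ w, ‖k w‖ₑ := by
    rw [withDensity_apply _ MeasurableSet.univ, Measure.restrict_univ]
  rw [← hu]
  refine eLpNorm_lintegral_le_of_forall_le hp ?_ ?_ (hu ▸ hk1)
  · unfold Function.uncurry
    fun_prop
  · intro w
    have : ENNReal.HolderTriple p₁ p₂ p := ⟨hpp.symm⟩
    have h1 := eLpNorm_smul_le_mul_eLpNorm (p := p₁) (q := p₂) (r := p) (μ := volume)
      (f := fun x ↦ g (x - w.2)) (φ := fun x ↦ f (x - w.1))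
      (by fun_prop : Measurable _).aestronglyMeasurable
      (by fun_prop : Measurable _).aestronglyMeasurable
    have e1 : eLpNorm (fun x ↦ f (x - w.1)) p₁ volume = eLpNorm f p₁ volume :=
      eLpNorm_comp_measurePreserving hf.aestronglyMeasurable (measurePreserving_sub_right volume w.1)
    have e2 : eLpNorm (fun x ↦ g (x - w.2)) p₂ volume = eLpNorm g p₂ volume :=
      eLpNorm_comp_measurePreserving hg.aestronglyMeasurable (measurePreserving_sub_right volume w.2)
    rw [e1, e2] at h1
    refine le_trans (eLpNorm_mono_enorm fun x ↦ ?_) h1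
    simp

end Convolution

section Operator

variable {m : Plane → Plane → ℂ}

theorem continuous_bilinearKernel
    (hm : Integrable (fun ζ : Plane × Plane ↦ m ζ.1 ζ.2) volume) :
    Continuous (fun w : Plane × Plane ↦ bilinearKernel m w.1 w.2) := by
  unfold bilinearKernel
  refine continuous_of_dominated (bound := fun ζ ↦ ‖m ζ.1 ζ.2‖) ?_ ?_ hm.norm ?_
  · intro w
    exact hm.1.mul (by fun_prop : Continuous _).aestronglyMeasurable
  · intro w
    refine Filter.Eventually.of_forall fun ζ ↦ ?_
    rw [norm_mul, Complex.norm_exp]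
    simp
  · exact Filter.Eventually.of_forall fun ζ ↦ by fun_prop

theorem bilinearIntegrand_congr_ae {f f' g g' : Plane → ℂ} (hf : f =ᵐ[volume] f')
    (hg : g =ᵐ[volume] g') (x : Plane) :
    bilinearIntegrand m f g x =ᵐ[volume] bilinearIntegrand m f' g' x := by
  have h1 := (Measure.quasiMeasurePreserving_fst (μ := (volume : Measure Plane))
    (ν := (volume : Measure Plane))).ae_eq_comp hf
  have h2 := (Measure.quasiMeasurePreserving_snd (μ := (volume : Measure Plane))
    (ν := (volume : Measure Plane))).ae_eq_comp hg
  filter_upwards [h1, h2] with w hw1 hw2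
  simp only [Function.comp] at hw1 hw2
  simp only [bilinearIntegrand, hw1, hw2]

/-- A bilinear multiplier operator with integrable kernel is bounded, with the `L¹` norm of the
kernel as the bound. -/
theorem bilinearOp_bound_of_kernel
    (hm : Integrable (fun ζ : Plane × Plane ↦ m ζ.1 ζ.2) volume) {A : ℝ≥0∞} (hA : A ≠ ⊤)
    (hK : ∫⁻ w : Plane × Plane, ‖bilinearKernel m w.1 w.2‖ₑ ≤ A)
    {p₁ p₂ p : ℝ≥0∞} (hp : 1 ≤ p) (hpp : p⁻¹ = p₁⁻¹ + p₂⁻¹) {f g : Plane → ℂ}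
    (hf : MemLp f p₁ volume) (hg : MemLp g p₂ volume) :
    (∀ᵐ x : Plane, Integrable (bilinearIntegrand m f g x) volume) ∧
      MemLp (bilinearOp m f g) p volume ∧
      eLpNorm (bilinearOp m f g) p volume ≤ A * eLpNorm f p₁ volume * eLpNorm g p₂ volume := by
  obtain ⟨f', hf', hff'⟩ := hf.1
  obtain ⟨g', hg', hgg'⟩ := hg.1
  have hae := bilinearIntegrand_congr_ae (m := m) hff' hgg'
  have hop : bilinearOp m f g = bilinearOp m f' g' := by
    ext x
    exact integral_congr_ae (hae x)
  have hk : Measurable (fun w : Plane × Plane ↦ bilinearKernel m w.1 w.2) :=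
    (continuous_bilinearKernel hm).measurable
  have hmeas : Measurable (fun z : Plane × (Plane × Plane) ↦
      bilinearIntegrand m f' g' z.1 z.2) := by
    exact measurable_bilinear_integrand hk hf'.measurable hg'.measurable
  have hbound := eLpNorm_lintegral_bilinear_le hk (ne_top_of_le_ne_top hA hK) hp hpp
    hf'.measurable hg'.measurable
  have hfin : (∫⁻ w : Plane × Plane, ‖bilinearKernel m w.1 w.2‖ₑ) *
      (eLpNorm f' p₁ volume * eLpNorm g' p₂ volume) < ⊤ := by
    rw [← eLpNorm_congr_ae hff', ← eLpNorm_congr_ae hgg']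
    exact ENNReal.mul_lt_top (hK.trans_lt hA.lt_top) (ENNReal.mul_lt_top hf.2 hg.2)
  have hHmeas : Measurable (fun x : Plane ↦ ∫⁻ w : Plane × Plane,
      ‖bilinearIntegrand m f' g' x w‖ₑ) := hmeas.enorm.lintegral_prod_right'
  have hbound' : eLpNorm (fun x : Plane ↦ ∫⁻ w : Plane × Plane,
      ‖bilinearIntegrand m f' g' x w‖ₑ) p volume ≤
      (∫⁻ w : Plane × Plane, ‖bilinearKernel m w.1 w.2‖ₑ) *
      (eLpNorm f' p₁ volume * eLpNorm g' p₂ volume) := hbound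
  have hle : eLpNorm (bilinearOp m f' g') p volume ≤
      (∫⁻ w : Plane × Plane, ‖bilinearKernel m w.1 w.2‖ₑ) *
      (eLpNorm f' p₁ volume * eLpNorm g' p₂ volume) := by
    refine le_trans (eLpNorm_mono_enorm fun x ↦ ?_) hbound'
    exact enorm_integral_le_lintegral_enorm _
  refine ⟨?_, ?_, ?_⟩
  · filter_upwards [ae_lt_top_of_eLpNorm_lt_top (zero_lt_one.trans_le hp).ne' hHmeas
      (hbound'.trans_lt hfin)] with x hx
    refine Integrable.congr ⟨?_, hx⟩ (hae x).symm
    exact (hmeas.comp measurable_prodMk_left).aestronglyMeasurable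
  · rw [hop]
    refine ⟨?_, hle.trans_lt hfin⟩
    exact (hmeas.stronglyMeasurable.integral_prod_right').aestronglyMeasurable
  · rw [hop, eLpNorm_congr_ae hff', eLpNorm_congr_ae hgg', mul_assoc]
    exact hle.trans (by gcongr)

end Operator

/-- The kernel formula and the Fourier formula agree on integrable functions, by Fubini. -/
theorem bilinearOp_eq_bilinearFourierOp {m : Plane → Plane → ℂ}
    (hm : Integrable (fun ζ : Plane × Plane ↦ m ζ.1 ζ.2) volume) {f g : Plane → ℂ}
    (hf : Integrable f volume) (hg : Integrable g volume) (x : Plane) :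
    bilinearOp m f g x = bilinearFourierOp m f g x := by
  have hfg : Integrable (fun w : Plane × Plane ↦ f w.1 * g w.2) volume := hf.mul_prod hg
  set e : Plane × Plane → Plane × Plane → ℂ := fun w ζ ↦
    Complex.exp (2 * Real.pi * Complex.I *
      (inner ℝ (x - w.1) ζ.1 + inner ℝ (x - w.2) ζ.2 : ℝ)) with he
  have hH : Integrable (Function.uncurry fun w ζ : Plane × Plane ↦
      e w ζ * ((f w.1 * g w.2) * m ζ.1 ζ.2)) (volume.prod volume) := by
    refine Integrable.bdd_mul (hfg.mul_prod hm) (c := 1) ?_ ?_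
    · exact (by rw [he]; fun_prop : Continuous fun z : (Plane × Plane) × (Plane × Plane) ↦
        e z.1 z.2).aestronglyMeasurable
    · refine Filter.Eventually.of_forall fun z ↦ ?_
      rw [he, Complex.norm_exp]
      simp
  have hL : bilinearOp m f g x = ∫ w, ∫ ζ, e w ζ * ((f w.1 * g w.2) * m ζ.1 ζ.2) := by
    refine integral_congr_ae (Filter.Eventually.of_forall fun w ↦ ?_)
    simp only [bilinearIntegrand, bilinearKernel]
    rw [mul_assoc, ← integral_mul_const]
    refine integral_congr_ae (Filter.Eventually.of_forall fun ζ ↦ ?_)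
    simp only [he]
    ring
  rw [hL, integral_integral_swap hH]
  refine integral_congr_ae (Filter.Eventually.of_forall fun ζ ↦ ?_)
  have hF : ∀ (h : Plane → ℂ) (ξ : Plane), 𝓕 h ξ =
      ∫ v, Complex.exp (-(2 * Real.pi * Complex.I * (inner ℝ v ξ : ℝ))) * h v := by
    intro h ξ
    rw [Real.fourier_eq']
    refine integral_congr_ae (Filter.Eventually.of_forall fun v ↦ ?_)
    simp only [smul_eq_mul]
    congr 2
    push_cast
    ring
  simp only
  rw [hF f, hF g, mul_assoc (m ζ.1 ζ.2), ← integral_prod_mul, mul_comm (m ζ.1 ζ.2), mul_assoc,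
    mul_comm, ← integral_const_mul]
  refine integral_congr_ae (Filter.Eventually.of_forall fun w ↦ ?_)
  have hexp : e w ζ = Complex.exp (2 * Real.pi * Complex.I * (inner ℝ x (ζ.1 + ζ.2) : ℝ)) *
      (Complex.exp (-(2 * Real.pi * Complex.I * (inner ℝ w.1 ζ.1 : ℝ))) *
        Complex.exp (-(2 * Real.pi * Complex.I * (inner ℝ w.2 ζ.2 : ℝ)))) := by
    rw [← Complex.exp_add, ← Complex.exp_add]
    simp only [he, inner_sub_left, inner_add_right]
    congr 1
    push_cast
    ring
  simp only [hexp]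
  ring

/-! ### The profile of the cutoff in the second frequency variable -/

theorem IsDyadicBump.eq_zero_of_lt {φ : ℝ → ℂ} (hφ : IsDyadicBump φ) {b : ℝ} (hb : b < 1 / 2) :
    φ b = 0 := by
  by_contra h
  exact absurd (hφ.2 (subset_tsupport φ h)).1 (not_le.2 hb)

theorem IsDyadicBump.eq_zero_of_gt {φ : ℝ → ℂ} (hφ : IsDyadicBump φ) {b : ℝ} (hb : 2 < b) :
    φ b = 0 := by
  by_contra h
  exact absurd (hφ.2 (subset_tsupport φ h)).2 (not_le.2 hb)

theorem IsDyadicBump.hasCompactSupport {φ : ℝ → ℂ} (hφ : IsDyadicBump φ) : HasCompactSupport φ :=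
  isCompact_Icc.of_isClosed_subset (isClosed_tsupport φ) hφ.2

theorem IsDyadicBump.contDiff_inv_mul {φ : ℝ → ℂ} (hφ : IsDyadicBump φ) :
    ContDiff ℝ ∞ (fun b : ℝ ↦ ((b⁻¹ : ℝ) : ℂ) * φ b) := by
  rw [contDiff_iff_contDiffAt]
  intro b
  rcases eq_or_ne b 0 with rfl | hb
  · have : (fun b : ℝ ↦ ((b⁻¹ : ℝ) : ℂ) * φ b) =ᶠ[nhds 0] fun _ ↦ 0 := by
      filter_upwards [Iio_mem_nhds (show (0 : ℝ) < 1 / 2 by norm_num)] with b hb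
      rw [hφ.eq_zero_of_lt hb, mul_zero]
    exact contDiffAt_const.congr_of_eventuallyEq this
  · exact (Complex.ofRealCLM.contDiff.contDiffAt.comp b (contDiffAt_inv ℝ hb)).mul
      hφ.1.contDiffAt

theorem SchwartzMap.hasDerivAt_fourierInv {f g : 𝓢(ℝ, ℂ)}
    (hfg : ∀ b : ℝ, g b = 2 * Real.pi * Complex.I * b * f b) (s : ℝ) :
    HasDerivAt (𝓕⁻ f : 𝓢(ℝ, ℂ)) ((𝓕⁻ g : 𝓢(ℝ, ℂ)) s) s := by
  have hneg : ∀ h : 𝓢(ℝ, ℂ), ∀ s, (𝓕⁻ h : 𝓢(ℝ, ℂ)) s = 𝓕 (h : ℝ → ℂ) (-s) := by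
    intro h s
    rw [SchwartzMap.fourierInv_coe, Real.fourierInv_eq_fourier_neg]
  have hint : Integrable (fun x : ℝ ↦ x • f x) volume := by
    have h2 := (g.integrable (μ := volume)).const_mul ((2 * Real.pi * Complex.I)⁻¹)
    refine h2.congr (Filter.Eventually.of_forall fun b ↦ ?_)
    simp only [hfg, Complex.real_smul]
    field_simp [Real.pi_ne_zero, Complex.I_ne_zero]
  have h := (Real.hasDerivAt_fourier (f.integrable (μ := volume)) hint (-s)).scomp s
    (hasDerivAt_neg s)
  have e : (⇑(𝓕⁻ f : 𝓢(ℝ, ℂ))) = 𝓕 (f : ℝ → ℂ) ∘ fun s ↦ -s := by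
    ext s
    exact hneg f s
  rw [e, hneg]
  refine h.congr_deriv ?_
  rw [neg_smul, one_smul, Real.fourier_eq', Real.fourier_eq', ← integral_neg]
  congr 1
  ext v
  simp only [smul_eq_mul, hfg]
  ring

/-- The profile `Φ(s) = ∫ |b| φ(b) e^{2πi b s} db` is the second derivative of a Schwartz function,
because `φ` vanishes near the origin. -/
theorem IsDyadicBump.exists_profile {φ : ℝ → ℂ} (hφ : IsDyadicBump φ) :
    ∃ P P' Φ : 𝓢(ℝ, ℂ), (∀ s, HasDerivAt P (P' s) s) ∧ (∀ s, HasDerivAt P' (Φ s) s) ∧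
      ∀ s : ℝ, Φ s = ∫ b : ℝ, (|b| : ℝ) * φ b * Complex.exp (2 * Real.pi * Complex.I * (b * s)) := by
  obtain ⟨f₀, hf₀⟩ : ∃ f : 𝓢(ℝ, ℂ), ∀ b : ℝ,
      f b = (2 * Real.pi * Complex.I : ℂ)⁻¹ ^ 2 * (((b⁻¹ : ℝ) : ℂ) * φ b) :=
    ⟨HasCompactSupport.toSchwartzMap (hφ.hasCompactSupport.mul_left.mul_left)
      (contDiff_const.mul hφ.contDiff_inv_mul), fun _ ↦ rfl⟩
  obtain ⟨f₁, hf₁⟩ : ∃ f : 𝓢(ℝ, ℂ), ∀ b : ℝ, f b = (2 * Real.pi * Complex.I : ℂ)⁻¹ * φ b :=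
    ⟨HasCompactSupport.toSchwartzMap (hφ.hasCompactSupport.mul_left)
      (contDiff_const.mul hφ.1), fun _ ↦ rfl⟩
  obtain ⟨f₂, hf₂⟩ : ∃ f : 𝓢(ℝ, ℂ), ∀ b : ℝ, f b = (b : ℂ) * φ b :=
    ⟨HasCompactSupport.toSchwartzMap (hφ.hasCompactSupport.mul_left)
      (Complex.ofRealCLM.contDiff.mul hφ.1), fun _ ↦ rfl⟩
  refine ⟨𝓕⁻ f₀, 𝓕⁻ f₁, 𝓕⁻ f₂, SchwartzMap.hasDerivAt_fourierInv fun b ↦ ?_,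
    SchwartzMap.hasDerivAt_fourierInv fun b ↦ ?_, fun s ↦ ?_⟩
  · rw [hf₀, hf₁]
    rcases eq_or_ne b 0 with rfl | hb
    · rw [hφ.eq_zero_of_lt (by norm_num)]
      simp
    · have hb' : (b : ℂ) ≠ 0 := by exact_mod_cast hb
      push_cast
      field_simp
  · rw [hf₁, hf₂]
    field_simp
  · rw [SchwartzMap.fourierInv_coe, Real.fourierInv_eq']
    refine integral_congr_ae (Filter.Eventually.of_forall fun b ↦ ?_)
    have hab : (b : ℂ) * φ b = (|b| : ℝ) * φ b := by
      rcases lt_or_ge b (1 / 2) with hb | hb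
      · rw [hφ.eq_zero_of_lt hb]
        simp
      · rw [abs_of_nonneg (by linarith)]
    simp only [hf₂, hab, smul_eq_mul]
    rw [mul_comm]
    congr 2
    simp
    ring

/-! ### Kernels of multipliers in the slope variables -/

theorem planeCoords_measurePreserving :
    MeasurePreserving (fun x : Plane ↦ (x 0, x 1)) volume volume :=
  (volume_preserving_finTwoArrow ℝ).comp (PiLp.volume_preserving_ofLp (Fin 2))

theorem planeCoords_measurableEmbedding :
    MeasurableEmbedding (fun x : Plane ↦ (x 0, x 1)) :=
  (MeasurableEquiv.finTwoArrow (α := ℝ)).measurableEmbedding.comp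
    (MeasurableEquiv.toLp 2 (Fin 2 → ℝ)).symm.measurableEmbedding

/-- A function of the slope `a / b`, cut off in `b`, is integrable on the plane. -/
theorem integrable_slope_mul {A φ : ℝ → ℂ} (hA : Measurable A) (hAi : Integrable A volume)
    (hφ : IsDyadicBump φ) :
    Integrable (fun p : ℝ × ℝ ↦ A (p.1 / p.2) * φ p.2) volume := by
  have hφc := hφ.1.continuous
  rw [Measure.volume_eq_prod, integrable_prod_iff']
  · refine ⟨Filter.Eventually.of_forall fun b ↦ ?_, ?_⟩
    · rcases eq_or_ne b 0 with rfl | hb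
      · simp [hφ.eq_zero_of_lt (show (0 : ℝ) < 1 / 2 by norm_num)]
      · exact Integrable.mul_const (f := fun a : ℝ ↦ A (a / b)) (hAi.comp_div hb) (φ b)
    · have : (fun b : ℝ ↦ ∫ a : ℝ, ‖A (a / b) * φ b‖) =
          fun b ↦ (|b| * ‖φ b‖) * ∫ a, ‖A a‖ := by
        ext b
        simp_rw [norm_mul]
        rw [integral_mul_const, Measure.integral_comp_div (fun a ↦ ‖A a‖), smul_eq_mul]
        ring
      simp only [this]
      refine Integrable.mul_const ?_ _
      exact Continuous.integrable_of_hasCompactSupport (by fun_prop)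
        hφ.hasCompactSupport.norm.mul_left
  · refine Measurable.aestronglyMeasurable ?_
    have := hφc.measurable
    fun_prop

/-- In the coordinates `(a, b) = (v b, b)`, integrating out `b` first turns the Fourier integral of
a function of the slope `v` into an average of the profile `Φ`. -/
theorem integral_slope_mul_exp {A φ : ℝ → ℂ} (hA : Measurable A) (hAi : Integrable A volume)
    (hφ : IsDyadicBump φ) {Φ : ℝ → ℂ}
    (hΦ : ∀ s : ℝ, Φ s = ∫ b : ℝ, (|b| : ℝ) * φ b *
      Complex.exp (2 * Real.pi * Complex.I * (b * s))) (z₀ z₁ : ℝ) :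
    ∫ p : ℝ × ℝ, A (p.1 / p.2) * φ p.2 *
        Complex.exp (2 * Real.pi * Complex.I * (z₀ * p.1 + z₁ * p.2 : ℝ)) =
      ∫ v : ℝ, A v * Φ (z₁ + v * z₀) := by
  have hφc := hφ.1.continuous
  have hint : Integrable (fun p : ℝ × ℝ ↦ A (p.1 / p.2) * φ p.2 *
      Complex.exp (2 * Real.pi * Complex.I * (z₀ * p.1 + z₁ * p.2 : ℝ)))
      (volume.prod volume) := by
    refine Integrable.mul_bdd (c := 1) (integrable_slope_mul hA hAi hφ)
      (by fun_prop : Continuous _).aestronglyMeasurable (Filter.Eventually.of_forall fun p ↦ ?_)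
    rw [Complex.norm_exp]
    simp
  have hint2 : Integrable (Function.uncurry fun b v : ℝ ↦ (((|b| : ℝ) : ℂ) * φ b * A v) *
      Complex.exp (2 * Real.pi * Complex.I * (b * (z₁ + v * z₀)))) (volume.prod volume) := by
    refine Integrable.mul_bdd (c := 1) (Integrable.mul_prod
      (f := fun b : ℝ ↦ ((|b| : ℝ) : ℂ) * φ b) ?_ hAi)
      (by fun_prop : Continuous _).aestronglyMeasurable (Filter.Eventually.of_forall fun p ↦ ?_)
    · exact Continuous.integrable_of_hasCompactSupport (by fun_prop) hφ.hasCompactSupport.mul_left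
    · rw [Complex.norm_exp]
      simp
  rw [Measure.volume_eq_prod, integral_prod_symm _ hint]
  have hinner : ∀ b : ℝ, ∫ a : ℝ, A (a / b) * φ b *
      Complex.exp (2 * Real.pi * Complex.I * (z₀ * a + z₁ * b : ℝ)) =
      ∫ v : ℝ, (((|b| : ℝ) : ℂ) * φ b * A v) *
        Complex.exp (2 * Real.pi * Complex.I * (b * (z₁ + v * z₀))) := by
    intro b
    rcases eq_or_ne b 0 with rfl | hb
    · simp [hφ.eq_zero_of_lt (show (0 : ℝ) < 1 / 2 by norm_num)]
    · have h := Measure.integral_comp_div (fun v : ℝ ↦ A v * φ b *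
        Complex.exp (2 * Real.pi * Complex.I * (z₀ * (v * b) + z₁ * b : ℝ))) b
      simp only [div_mul_cancel₀ _ hb] at h
      rw [h, Complex.real_smul, ← integral_const_mul]
      refine integral_congr_ae (Filter.Eventually.of_forall fun v ↦ ?_)
      simp only
      rw [show (2 * Real.pi * Complex.I * (z₀ * (v * b) + z₁ * b : ℝ) : ℂ) =
        2 * Real.pi * Complex.I * (b * (z₁ + v * z₀)) by push_cast; ring]
      ring
  simp_rw [hinner]
  rw [integral_integral_swap hint2]
  refine integral_congr_ae (Filter.Eventually.of_forall fun v ↦ ?_)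
  simp only
  rw [hΦ, ← integral_const_mul]
  refine integral_congr_ae (Filter.Eventually.of_forall fun b ↦ ?_)
  simp only
  push_cast
  ring

section Slope

variable {M : ℝ → ℝ → ℂ} {φ : ℝ → ℂ}

/-- Bounded measurable functions supported in the square `[-1, 1]²`. -/
structure IsSquareBounded (M : ℝ → ℝ → ℂ) : Prop where
  measurable : Measurable (Function.uncurry M)
  bounded : ∃ C, ∀ u v, ‖M u v‖ ≤ C
  support : ∀ u v, M u v ≠ 0 → u ∈ Icc (-1 : ℝ) 1 ∧ v ∈ Icc (-1 : ℝ) 1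

theorem IsSquareBounded.exists_le (hM : IsSquareBounded M) : ∃ C : ℝ, ∀ u v,
    ‖M u v‖ ≤ C * ‖(Icc (-1 : ℝ) 1).indicator (1 : ℝ → ℂ) u‖ *
      ‖(Icc (-1 : ℝ) 1).indicator (1 : ℝ → ℂ) v‖ := by
  obtain ⟨C, hC⟩ := hM.bounded
  refine ⟨C, fun u v ↦ ?_⟩
  rcases eq_or_ne (M u v) 0 with h0 | h0
  · rw [h0, norm_zero]
    have : 0 ≤ C := (norm_nonneg _).trans (hC u v)
    positivity
  · obtain ⟨hu, hv⟩ := hM.support u v h0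
    simpa [indicator_of_mem hu, indicator_of_mem hv] using hC u v

theorem integrable_indicator_Icc :
    Integrable ((Icc (-1 : ℝ) 1).indicator (1 : ℝ → ℂ)) volume := by
  rw [integrable_indicator_iff measurableSet_Icc]
  exact continuousOn_const.integrableOn_compact isCompact_Icc

theorem IsSquareBounded.integrable (hM : IsSquareBounded M) :
    Integrable (Function.uncurry M) (volume.prod volume) := by
  obtain ⟨C, hC⟩ := hM.exists_le
  refine Integrable.mono' (((integrable_indicator_Icc.mul_prod
    integrable_indicator_Icc).norm.const_mul C)) hM.measurable.aestronglyMeasurable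
    (Filter.Eventually.of_forall fun p ↦ ?_)
  rw [norm_mul, ← mul_assoc]
  exact hC p.1 p.2

theorem IsSquareBounded.integrable_right (hM : IsSquareBounded M) (u : ℝ) :
    Integrable (M u) volume := by
  obtain ⟨C, hC⟩ := hM.exists_le
  exact Integrable.mono' (integrable_indicator_Icc.norm.const_mul _)
    (hM.measurable.comp measurable_prodMk_left).aestronglyMeasurable
    (Filter.Eventually.of_forall (hC u))

theorem IsSquareBounded.swap (hM : IsSquareBounded M) : IsSquareBounded fun v u ↦ M u v where
  measurable := hM.measurable.comp measurable_swap
  bounded := hM.bounded.imp fun _ h v u ↦ h u v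
  support v u h := (hM.support u v h).symm

theorem IsSquareBounded.mul_left (hM : IsSquareBounded M) {Φ : ℝ → ℂ} (hΦ : Measurable Φ)
    (hb : ∃ C, ∀ s, ‖Φ s‖ ≤ C) {w : ℝ × ℝ → ℝ} (hw : Measurable w) :
    IsSquareBounded fun u v ↦ M u v * Φ (w (u, v)) where
  measurable := hM.measurable.mul (hΦ.comp hw)
  bounded := by
    obtain ⟨C, hC⟩ := hM.bounded
    obtain ⟨D, hD⟩ := hb
    refine ⟨C * D, fun u v ↦ ?_⟩
    rw [norm_mul]
    exact mul_le_mul (hC u v) (hD _) (norm_nonneg _) ((norm_nonneg _).trans (hC u v))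
  support u v h := hM.support u v (left_ne_zero_of_mul h)

theorem IsSquareBounded.integrable_slope (hM : IsSquareBounded M) (hφ : IsDyadicBump φ) :
    Integrable (fun ζ : Plane × Plane ↦
      M (ζ.1 0 / ζ.1 1) (ζ.2 0 / ζ.2 1) * φ (ζ.1 1) * φ (ζ.2 1)) volume := by
  obtain ⟨C, hC⟩ := hM.exists_le
  have h1 : Integrable (fun ξ : Plane ↦
      (Icc (-1 : ℝ) 1).indicator (1 : ℝ → ℂ) (ξ 0 / ξ 1) * φ (ξ 1)) volume :=
    (planeCoords_measurePreserving.integrable_comp_emb planeCoords_measurableEmbedding).2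
      (integrable_slope_mul (measurable_one.indicator measurableSet_Icc)
        integrable_indicator_Icc hφ)
  have hφm := hφ.1.continuous.measurable
  refine Integrable.mono' ((h1.mul_prod h1).norm.const_mul C) ?_
    (Filter.Eventually.of_forall fun ζ ↦ ?_)
  · refine Measurable.aestronglyMeasurable ?_
    have hMm : Measurable fun ζ : Plane × Plane ↦ M (ζ.1 0 / ζ.1 1) (ζ.2 0 / ζ.2 1) :=
      hM.measurable.comp (by fun_prop : Measurable fun ζ : Plane × Plane ↦
        (ζ.1 0 / ζ.1 1, ζ.2 0 / ζ.2 1))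
    exact (hMm.mul (hφm.comp (by fun_prop))).mul (hφm.comp (by fun_prop))
  · have := hC (ζ.1 0 / ζ.1 1) (ζ.2 0 / ζ.2 1)
    simp only [norm_mul]
    calc _ ≤ (C * ‖(Icc (-1 : ℝ) 1).indicator (1 : ℝ → ℂ) (ζ.1 0 / ζ.1 1)‖ *
          ‖(Icc (-1 : ℝ) 1).indicator (1 : ℝ → ℂ) (ζ.2 0 / ζ.2 1)‖) *
          ‖φ (ζ.1 1)‖ * ‖φ (ζ.2 1)‖ := by gcongr
      _ = _ := by ring

/-- The kernel of a multiplier that depends on the slopes of `ξ` and `η` only (up to the cutoffs in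
`ξ₂, η₂`) is a superposition of tensor products of profiles. -/
theorem bilinearKernel_slope (hM : IsSquareBounded M) (hφ : IsDyadicBump φ) {Φ : 𝓢(ℝ, ℂ)}
    (hΦ : ∀ s : ℝ, Φ s = ∫ b : ℝ, (|b| : ℝ) * φ b *
      Complex.exp (2 * Real.pi * Complex.I * (b * s))) (y z : Plane) :
    bilinearKernel (fun ξ η ↦ M (ξ 0 / ξ 1) (η 0 / η 1) * φ (ξ 1) * φ (η 1)) y z =
      ∫ u, (∫ v, M u v * Φ (z 1 + v * z 0)) * Φ (y 1 + u * y 0) := by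
  have hinner : ∀ x ξ : Plane, inner ℝ x ξ = x 0 * ξ 0 + x 1 * ξ 1 := by
    intro x ξ
    simp [PiLp.inner_apply, Fin.sum_univ_two, mul_comm]
  have hb : ∃ C, ∀ s, ‖Φ s‖ ≤ C := by
    obtain ⟨C, -, hC⟩ := Φ.decay 0 0
    exact ⟨C, fun s ↦ by simpa using hC s⟩
  set A : ℝ → ℂ := fun u ↦ ∫ v, M u v * Φ (z 1 + v * z 0) with hA
  have hMΦ := hM.mul_left Φ.continuous.measurable hb
    (w := fun q ↦ z 1 + q.2 * z 0) (by fun_prop)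
  have hAm : Measurable A := hMΦ.measurable.stronglyMeasurable.integral_prod_right.measurable
  have hAi : Integrable A volume := hMΦ.integrable.integral_prod_left
  have hplane : ∀ (B : ℝ → ℂ), Measurable B → Integrable B volume → ∀ x : Plane,
      ∫ η : Plane, B (η 0 / η 1) * φ (η 1) *
        Complex.exp (2 * Real.pi * Complex.I * (inner ℝ x η : ℝ)) =
      ∫ v, B v * Φ (x 1 + v * x 0) := by
    intro B hB hBi x
    rw [← integral_slope_mul_exp hB hBi hφ hΦ, ← planeCoords_measurePreserving.integral_comp
      planeCoords_measurableEmbedding]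
    simp only [hinner]
  rw [← hplane A hAm hAi y]
  unfold bilinearKernel
  rw [Measure.volume_eq_prod, integral_prod]
  · refine integral_congr_ae (Filter.Eventually.of_forall fun ξ ↦ ?_)
    simp only [hA]
    rw [← hplane (M (ξ 0 / ξ 1)) (hM.measurable.comp measurable_prodMk_left)
      (hM.integrable_right _) z, mul_assoc _ (φ (ξ 1)), ← integral_mul_const]
    refine integral_congr_ae (Filter.Eventually.of_forall fun η ↦ ?_)
    simp only
    rw [Complex.ofReal_add, mul_add, Complex.exp_add]
    ring
  · refine Integrable.mul_bdd (c := 1) (hM.integrable_slope hφ)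
      (by fun_prop : Continuous _).aestronglyMeasurable (Filter.Eventually.of_forall fun p ↦ ?_)
    rw [Complex.norm_exp]
    simp

end Slope

/-! ### The `L¹` norm of slope averages -/

section Profile

theorem SchwartzMap.exists_norm_le (Φ : 𝓢(ℝ, ℂ)) : ∃ C, ∀ s, ‖Φ s‖ ≤ C := by
  obtain ⟨C, -, hC⟩ := Φ.decay 0 0
  exact ⟨C, fun s ↦ by simpa using hC s⟩

theorem integrable_mul_schwartz_affine {F : ℝ → ℂ} (hF : Integrable F volume) (Φ : 𝓢(ℝ, ℂ))
    (y₀ y₁ : ℝ) : Integrable (fun u ↦ F u * Φ (y₁ + u * y₀)) volume := by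
  obtain ⟨C, hC⟩ := Φ.exists_norm_le
  exact hF.mul_bdd (c := C)
    (Φ.continuous.comp (by fun_prop : Continuous fun u : ℝ ↦ y₁ + u * y₀)).aestronglyMeasurable
    (Filter.Eventually.of_forall fun u ↦ hC _)

theorem integral_mul_schwartz_deriv {P Φ : 𝓢(ℝ, ℂ)} (hP : ∀ s, HasDerivAt P (Φ s) s)
    {F F' : ℝ → ℂ} (hF : ∀ u, HasDerivAt F (F' u) u) (hFi : Integrable F volume)
    (hFi' : Integrable F' volume) (y₀ y₁ : ℝ) :
    (y₀ : ℂ) * ∫ u, F u * Φ (y₁ + u * y₀) = -∫ u, F' u * P (y₁ + u * y₀) := by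
  rw [← integral_mul_deriv_eq_deriv_mul_of_integrable (u := F)
    (v' := fun u ↦ (y₀ : ℂ) * Φ (y₁ + u * y₀)), ← integral_const_mul]
  · refine integral_congr_ae (Filter.Eventually.of_forall fun u ↦ ?_)
    simp only
    ring
  · exact fun u _ ↦ hF u
  · intro u _
    have h1 : HasDerivAt (fun u : ℝ ↦ y₁ + u * y₀) y₀ u := by
      simpa using ((hasDerivAt_id u).mul_const y₀).const_add y₁
    exact ((hP (y₁ + u * y₀)).scomp u h1).congr_deriv (by simp)
  · refine ((integrable_mul_schwartz_affine hFi Φ y₀ y₁).const_mul (y₀ : ℂ)).congr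
      (Filter.Eventually.of_forall fun u ↦ ?_)
    simp only [Pi.mul_apply]
    ring
  · exact integrable_mul_schwartz_affine hFi' P y₀ y₁
  · exact integrable_mul_schwartz_affine hFi P y₀ y₁

/-- Integrating by parts twice against a profile with a second primitive gains `y₀⁻²`. -/
theorem sq_mul_integral_mul_profile {P P' Φ : 𝓢(ℝ, ℂ)} (hP : ∀ s, HasDerivAt P (P' s) s)
    (hP' : ∀ s, HasDerivAt P' (Φ s) s) {F F' F'' : ℝ → ℂ} (hF : ∀ u, HasDerivAt F (F' u) u)
    (hF' : ∀ u, HasDerivAt F' (F'' u) u) (hFi : Integrable F volume)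
    (hFi' : Integrable F' volume) (hFi'' : Integrable F'' volume) (y₀ y₁ : ℝ) :
    (y₀ : ℂ) ^ 2 * ∫ u, F u * Φ (y₁ + u * y₀) = ∫ u, F'' u * P (y₁ + u * y₀) := by
  rw [sq, mul_assoc, integral_mul_schwartz_deriv hP' hF hFi hFi', mul_neg,
    integral_mul_schwartz_deriv hP hF' hFi' hFi'', neg_neg]

theorem lintegral_integral_mul_schwartz_le {F : ℝ → ℂ} (hF : Measurable F) (Φ : 𝓢(ℝ, ℂ))
    (y₀ : ℝ) :
    ∫⁻ y₁, ‖∫ u, F u * Φ (y₁ + u * y₀)‖ₑ ≤ (∫⁻ s, ‖Φ s‖ₑ) * ∫⁻ u, ‖F u‖ₑ := by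
  have hΦ := Φ.continuous.measurable
  calc ∫⁻ y₁, ‖∫ u, F u * Φ (y₁ + u * y₀)‖ₑ
      ≤ ∫⁻ y₁, ∫⁻ u, ‖F u‖ₑ * ‖Φ (y₁ + u * y₀)‖ₑ := by
        refine lintegral_mono fun y₁ ↦ (enorm_integral_le_lintegral_enorm _).trans_eq ?_
        simp [enorm_mul]
    _ = ∫⁻ u, ∫⁻ y₁, ‖F u‖ₑ * ‖Φ (y₁ + u * y₀)‖ₑ := by
        rw [lintegral_lintegral_swap]
        fun_prop
    _ = ∫⁻ u, ‖F u‖ₑ * ∫⁻ s, ‖Φ s‖ₑ := by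
        refine lintegral_congr fun u ↦ ?_
        rw [lintegral_const_mul _ (by fun_prop),
          lintegral_add_right_eq_self (fun s ↦ ‖Φ s‖ₑ) (u * y₀)]
    _ = _ := by rw [lintegral_mul_const _ (by fun_prop), mul_comm]

theorem lintegral_inv_one_add_mul_sq {δ : ℝ} (hδ : 0 < δ) :
    ∫⁻ y : ℝ, ENNReal.ofReal (1 + (δ * y) ^ 2)⁻¹ = ENNReal.ofReal (Real.pi / δ) := by
  rw [← ofReal_integral_eq_lintegral_ofReal]
  · congr 1
    rw [Measure.integral_comp_mul_left (fun y : ℝ ↦ (1 + y ^ 2)⁻¹) δ,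
      integral_univ_inv_one_add_sq, smul_eq_mul, abs_of_pos (inv_pos.2 hδ)]
    field_simp
  · exact integrable_inv_one_add_sq.comp_mul_left' hδ.ne'
  · exact Filter.Eventually.of_forall fun y ↦ by positivity

theorem measurable_integral_mul_schwartz {F : ℝ → ℂ} (hF : Measurable F) (Φ : 𝓢(ℝ, ℂ)) :
    Measurable fun p : ℝ × ℝ ↦ ∫ u, F u * Φ (p.2 + u * p.1) := by
  have hΦ := Φ.continuous.measurable
  have : Measurable (Function.uncurry fun (p : ℝ × ℝ) (u : ℝ) ↦ F u * Φ (p.2 + u * p.1)) := by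
    unfold Function.uncurry
    fun_prop
  exact this.stronglyMeasurable.integral_prod_right.measurable

/-- The `L¹(ℝ²)` norm of `(y₀, y₁) ↦ ∫ F(u) Φ(y₁ + u y₀) du`, when two integrations by parts in `u`
turn `F` into `F₂` and the profile `Φ` into `P`: the pointwise decay `(1 + (δ y₀)²)⁻¹` interpolates
between no and two integrations by parts. -/
theorem lintegral_slope_average_le {P Φ : 𝓢(ℝ, ℂ)} {F F₂ : ℝ → ℂ} (hF : Measurable F)
    (hF₂ : Measurable F₂)
    (h : ∀ y₀ y₁ : ℝ, (y₀ : ℂ) ^ 2 * ∫ u, F u * Φ (y₁ + u * y₀) = ∫ u, F₂ u * P (y₁ + u * y₀))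
    {δ : ℝ} (hδ : 0 < δ) :
    ∫⁻ p : ℝ × ℝ, ‖∫ u, F u * Φ (p.2 + u * p.1)‖ₑ ≤
      ENNReal.ofReal (Real.pi / δ) * ((∫⁻ s, ‖Φ s‖ₑ) + ∫⁻ s, ‖P s‖ₑ) *
        ((∫⁻ u, ‖F u‖ₑ) + ENNReal.ofReal (δ ^ 2) * ∫⁻ u, ‖F₂ u‖ₑ) := by
  set A := (∫⁻ s, ‖Φ s‖ₑ) + ∫⁻ s, ‖P s‖ₑ with hA
  set N := (∫⁻ u, ‖F u‖ₑ) + ENNReal.ofReal (δ ^ 2) * ∫⁻ u, ‖F₂ u‖ₑ with hN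
  have hslice : ∀ y₀ : ℝ, ∫⁻ y₁, ‖∫ u, F u * Φ (y₁ + u * y₀)‖ₑ ≤
      ENNReal.ofReal (1 + (δ * y₀) ^ 2)⁻¹ * (A * N) := by
    intro y₀
    set G := ∫⁻ y₁, ‖∫ u, F u * Φ (y₁ + u * y₀)‖ₑ with hG
    have h1 : G ≤ A * ∫⁻ u, ‖F u‖ₑ :=
      (lintegral_integral_mul_schwartz_le hF Φ y₀).trans (by gcongr; exact le_self_add)
    have h2 : ENNReal.ofReal (y₀ ^ 2) * G ≤ A * ∫⁻ u, ‖F₂ u‖ₑ := by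
      have e : ENNReal.ofReal (y₀ ^ 2) * G = ∫⁻ y₁, ‖∫ u, F₂ u * P (y₁ + u * y₀)‖ₑ := by
        rw [hG, ← lintegral_const_mul' _ _ ENNReal.ofReal_ne_top]
        refine lintegral_congr fun y₁ ↦ ?_
        rw [← h, enorm_mul]
        congr 1
        rw [← ofReal_norm, norm_pow, Complex.norm_real, Real.norm_eq_abs, sq_abs]
      rw [e]
      exact (lintegral_integral_mul_schwartz_le hF₂ P y₀).trans (by gcongr; exact le_add_self)
    have h3 : ENNReal.ofReal (1 + (δ * y₀) ^ 2) * G ≤ A * N := by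
      rw [ENNReal.ofReal_add zero_le_one (sq_nonneg _), ENNReal.ofReal_one, add_mul, one_mul, hN,
        mul_add, mul_pow, ENNReal.ofReal_mul (sq_nonneg _), mul_assoc, mul_left_comm A]
      gcongr
    rw [ENNReal.ofReal_inv_of_pos (by positivity), mul_comm, ← div_eq_mul_inv,
      ENNReal.le_div_iff_mul_le (Or.inl (by positivity)) (Or.inl ENNReal.ofReal_ne_top), mul_comm]
    exact h3
  rw [Measure.volume_eq_prod, lintegral_prod _
    (measurable_integral_mul_schwartz hF Φ).enorm.aemeasurable]
  calc _ ≤ ∫⁻ y₀ : ℝ, ENNReal.ofReal (1 + (δ * y₀) ^ 2)⁻¹ * (A * N) := lintegral_mono hslice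
    _ = _ := by
      rw [lintegral_mul_const _ (by fun_prop), lintegral_inv_one_add_mul_sq hδ, mul_assoc]

end Profile

section Tensor

variable {M Muu Mvv Muuvv : ℝ → ℝ → ℂ} {P Φ : 𝓢(ℝ, ℂ)}

theorem measurable_slope_integral {N : ℝ → ℝ → ℂ} (hN : IsSquareBounded N) (Φ : 𝓢(ℝ, ℂ)) :
    Measurable fun t : ℝ × (ℝ × ℝ) ↦ ∫ v, N t.1 v * Φ (t.2.2 + v * t.2.1) := by
  have h1 : Measurable (Function.uncurry fun (t : ℝ × (ℝ × ℝ)) (v : ℝ) ↦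
      N t.1 v * Φ (t.2.2 + v * t.2.1)) := by
    have h2 : Measurable fun s : (ℝ × (ℝ × ℝ)) × ℝ ↦ N s.1.1 s.2 :=
      hN.measurable.comp (measurable_fst.fst.prodMk measurable_snd)
    exact h2.mul (Φ.continuous.measurable.comp (by fun_prop))
  exact h1.stronglyMeasurable.integral_prod_right.measurable

/-- The two-variable form of `lintegral_slope_average_le`, obtained by applying it in each
variable. -/
theorem lintegral_slope_average_tensor_le (hM : IsSquareBounded M) (hMuu : IsSquareBounded Muu)
    (hMvv : IsSquareBounded Mvv) (hMuuvv : IsSquareBounded Muuvv)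
    (hu : ∀ v y₀ y₁ : ℝ, (y₀ : ℂ) ^ 2 * ∫ u, M u v * Φ (y₁ + u * y₀) =
      ∫ u, Muu u v * P (y₁ + u * y₀))
    (hv : ∀ u z₀ z₁ : ℝ, (z₀ : ℂ) ^ 2 * ∫ v, M u v * Φ (z₁ + v * z₀) =
      ∫ v, Mvv u v * P (z₁ + v * z₀))
    (huv : ∀ u z₀ z₁ : ℝ, (z₀ : ℂ) ^ 2 * ∫ v, Muu u v * Φ (z₁ + v * z₀) =
      ∫ v, Muuvv u v * P (z₁ + v * z₀)) {δ : ℝ} (hδ : 0 < δ) :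
    ∫⁻ q : ℝ × ℝ, ∫⁻ p : ℝ × ℝ,
        ‖∫ u, (∫ v, M u v * Φ (q.2 + v * q.1)) * Φ (p.2 + u * p.1)‖ₑ ≤
      (ENNReal.ofReal (Real.pi / δ) * ((∫⁻ s, ‖Φ s‖ₑ) + ∫⁻ s, ‖P s‖ₑ)) ^ 2 *
        (((∫⁻ u, ∫⁻ v, ‖M u v‖ₑ) + ENNReal.ofReal (δ ^ 2) * ∫⁻ u, ∫⁻ v, ‖Mvv u v‖ₑ) +
          ENNReal.ofReal (δ ^ 2) * ((∫⁻ u, ∫⁻ v, ‖Muu u v‖ₑ) +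
            ENNReal.ofReal (δ ^ 2) * ∫⁻ u, ∫⁻ v, ‖Muuvv u v‖ₑ)) := by
  set K := ENNReal.ofReal (Real.pi / δ) * ((∫⁻ s, ‖Φ s‖ₑ) + ∫⁻ s, ‖P s‖ₑ) with hK
  have hΦm := Φ.continuous.measurable
  have hmeas : ∀ N : ℝ → ℝ → ℂ, IsSquareBounded N → ∀ q : ℝ × ℝ,
      Measurable fun u ↦ ∫ v, N u v * Φ (q.2 + v * q.1) := fun N hN q ↦
    (measurable_slope_integral hN Φ).comp (measurable_id.prodMk measurable_const)
  have hswap : ∀ N : ℝ → ℝ → ℂ, IsSquareBounded N → ∀ Θ : 𝓢(ℝ, ℂ), ∀ (q : ℝ × ℝ) (y₀ y₁ : ℝ),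
      ∫ u, (∫ v, N u v * Φ (q.2 + v * q.1)) * Θ (y₁ + u * y₀) =
        ∫ v, (∫ u, N u v * Θ (y₁ + u * y₀)) * Φ (q.2 + v * q.1) := by
    intro N hN Θ q y₀ y₁
    have h1 := (hN.mul_left hΦm Φ.exists_norm_le (w := fun r ↦ q.2 + r.2 * q.1)
      (by fun_prop)).mul_left Θ.continuous.measurable Θ.exists_norm_le
      (w := fun r ↦ y₁ + r.1 * y₀) (by fun_prop)
    simp_rw [← integral_mul_const]
    rw [integral_integral_swap h1.integrable]
    refine integral_congr_ae (Filter.Eventually.of_forall fun v ↦ integral_congr_ae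
      (Filter.Eventually.of_forall fun u ↦ ?_))
    simp only
    ring
  -- for fixed `q`, the one-variable estimate in `u`, whose hypothesis survives the averaging in `v`
  have hfirst : ∀ q : ℝ × ℝ, ∫⁻ p : ℝ × ℝ,
      ‖∫ u, (∫ v, M u v * Φ (q.2 + v * q.1)) * Φ (p.2 + u * p.1)‖ₑ ≤
      K * ((∫⁻ u, ‖∫ v, M u v * Φ (q.2 + v * q.1)‖ₑ) +
        ENNReal.ofReal (δ ^ 2) * ∫⁻ u, ‖∫ v, Muu u v * Φ (q.2 + v * q.1)‖ₑ) := by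
    intro q
    refine lintegral_slope_average_le (hmeas M hM q) (hmeas Muu hMuu q) (fun y₀ y₁ ↦ ?_) hδ
    rw [hswap M hM Φ, hswap Muu hMuu P, ← integral_const_mul]
    refine integral_congr_ae (Filter.Eventually.of_forall fun v ↦ ?_)
    simp only
    rw [← mul_assoc, hu]
  -- for fixed `u`, the one-variable estimate in `v`
  have hsecond : ∀ N Nvv : ℝ → ℝ → ℂ, IsSquareBounded N → IsSquareBounded Nvv →
      (∀ u z₀ z₁ : ℝ, (z₀ : ℂ) ^ 2 * ∫ v, N u v * Φ (z₁ + v * z₀) =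
        ∫ v, Nvv u v * P (z₁ + v * z₀)) →
      ∫⁻ q : ℝ × ℝ, ∫⁻ u, ‖∫ v, N u v * Φ (q.2 + v * q.1)‖ₑ ≤
        K * ((∫⁻ u, ∫⁻ v, ‖N u v‖ₑ) + ENNReal.ofReal (δ ^ 2) * ∫⁻ u, ∫⁻ v, ‖Nvv u v‖ₑ) := by
    intro N Nvv hN hNvv h
    rw [lintegral_lintegral_swap]
    · calc _ ≤ ∫⁻ u, K * ((∫⁻ v, ‖N u v‖ₑ) + ENNReal.ofReal (δ ^ 2) * ∫⁻ v, ‖Nvv u v‖ₑ) := by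
            refine lintegral_mono fun u ↦ ?_
            exact lintegral_slope_average_le (hN.measurable.comp measurable_prodMk_left)
              (hNvv.measurable.comp measurable_prodMk_left) (h u) hδ
        _ = _ := by
            have m1 : Measurable fun u ↦ ∫⁻ v, ‖N u v‖ₑ := hN.measurable.enorm.lintegral_prod_right
            have m2 : Measurable fun u ↦ ∫⁻ v, ‖Nvv u v‖ₑ :=
              hNvv.measurable.enorm.lintegral_prod_right
            rw [lintegral_const_mul _ (by fun_prop), lintegral_add_left m1,
              lintegral_const_mul _ m2]
    · exact ((measurable_slope_integral hN Φ).comp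
        (measurable_snd.prodMk measurable_fst)).enorm.aemeasurable
  have m3 : ∀ N : ℝ → ℝ → ℂ, IsSquareBounded N →
      Measurable fun q : ℝ × ℝ ↦ ∫⁻ u, ‖∫ v, N u v * Φ (q.2 + v * q.1)‖ₑ := fun N hN ↦
    ((measurable_slope_integral hN Φ).comp
      (measurable_snd.prodMk measurable_fst)).enorm.lintegral_prod_right'
  calc _ ≤ ∫⁻ q : ℝ × ℝ, K * ((∫⁻ u, ‖∫ v, M u v * Φ (q.2 + v * q.1)‖ₑ) +
        ENNReal.ofReal (δ ^ 2) * ∫⁻ u, ‖∫ v, Muu u v * Φ (q.2 + v * q.1)‖ₑ) :=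
        lintegral_mono hfirst
    _ = K * ((∫⁻ q : ℝ × ℝ, ∫⁻ u, ‖∫ v, M u v * Φ (q.2 + v * q.1)‖ₑ) +
        ENNReal.ofReal (δ ^ 2) *
          ∫⁻ q : ℝ × ℝ, ∫⁻ u, ‖∫ v, Muu u v * Φ (q.2 + v * q.1)‖ₑ) := by
      have m3M := m3 M hM
      have m3uu := m3 Muu hMuu
      rw [lintegral_const_mul _ (by fun_prop), lintegral_add_left m3M, lintegral_const_mul _ m3uu]
    _ ≤ K * (K * ((∫⁻ u, ∫⁻ v, ‖M u v‖ₑ) + ENNReal.ofReal (δ ^ 2) * ∫⁻ u, ∫⁻ v, ‖Mvv u v‖ₑ) +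
        ENNReal.ofReal (δ ^ 2) * (K * ((∫⁻ u, ∫⁻ v, ‖Muu u v‖ₑ) +
            ENNReal.ofReal (δ ^ 2) * ∫⁻ u, ∫⁻ v, ‖Muuvv u v‖ₑ))) := by
      gcongr
      · exact hsecond M Mvv hM hMvv hv
      · exact hsecond Muu Muuvv hMuu hMuuvv huv
    _ = _ := by ring

end Tensor

/-! ### Dyadic resolution of the power singularity -/

/-- A smooth dyadic resolution of the power `Q₊ ^ lam` on `(-∞, 1]`: `Q₊ ^ lam` is the sum over `n`
of the nonnegative pieces `2 ^ (-lam n) g(2 ^ n Q)` with `g = g 0` supported in `[1/2, 2]`; the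
sequence `g` lists the derivatives of `g 0`. -/
theorem exists_dyadic_rpow {lam : ℝ} (hlam : 0 < lam) :
    ∃ g : ℕ → ℝ → ℝ, (∀ i t, HasDerivAt (g i) (g (i + 1) t) t) ∧
      (∀ i t, g i t ≠ 0 → t ∈ Icc (1 / 2 : ℝ) 2) ∧ (∃ C, ∀ i ≤ 4, ∀ t, |g i t| ≤ C) ∧
      (∀ t, 0 ≤ g 0 t) ∧
      ∀ Q ≤ 1, HasSum (fun n : ℕ ↦ ((2 ^ n : ℝ)⁻¹) ^ lam * g 0 (2 ^ n * Q)) (max Q 0 ^ lam) := by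
  set θ : ℝ → ℝ := fun t ↦ Real.smoothTransition (t - 1) with hθ
  have hθ0 : ∀ t ≤ 1, θ t = 0 := fun t ht ↦ Real.smoothTransition.zero_of_nonpos (by linarith)
  have hθ1 : ∀ t, 2 ≤ t → θ t = 1 := fun t ht ↦ Real.smoothTransition.one_of_one_le (by linarith)
  have hθm : Monotone θ := fun s t h ↦ Real.smoothTransition.monotone (by linarith)
  have hθs : ContDiff ℝ ∞ θ := Real.smoothTransition.contDiff.comp (contDiff_id.sub contDiff_const)
  set G : ℝ → ℝ := fun t ↦ (θ (2 * t) - θ t) * t ^ lam with hG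
  have hG0 : ∀ t < 1 / 2, G t = 0 := by
    intro t ht
    simp [hG, hθ0 (2 * t) (by linarith), hθ0 t (by linarith)]
  have hGs : ContDiff ℝ ∞ G := by
    rw [contDiff_iff_contDiffAt]
    intro t
    rcases lt_or_ge t (1 / 2) with ht | ht
    · refine (contDiffAt_const (c := (0 : ℝ))).congr_of_eventuallyEq ?_
      filter_upwards [Iio_mem_nhds ht] with s hs using hG0 s hs
    · have h1 : ContDiff ℝ ∞ fun t ↦ θ (2 * t) - θ t :=
        (hθs.comp (contDiff_const.mul contDiff_id)).sub hθs
      exact h1.contDiffAt.mul (Real.contDiffAt_rpow_const_of_ne (by linarith))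
  have hsupp : tsupport G ⊆ Icc (1 / 2 : ℝ) 2 := by
    refine closure_minimal (fun t ht ↦ ⟨?_, ?_⟩) isClosed_Icc
    · by_contra h
      exact ht (hG0 t (not_le.1 h))
    · by_contra h
      push Not at h
      exact ht (by simp [hG, hθ1 (2 * t) (by linarith), hθ1 t h.le])
  have hsuppi : ∀ i, tsupport (iteratedDeriv i G) ⊆ Icc (1 / 2 : ℝ) 2 := by
    intro i
    induction i with
    | zero => simpa using hsupp
    | succ i ih =>
      rw [iteratedDeriv_succ]
      exact (closure_minimal support_deriv_subset (isClosed_tsupport _)).trans ih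
  refine ⟨fun i ↦ iteratedDeriv i G, fun i t ↦ ?_, fun i t h ↦ hsuppi i (subset_tsupport _ h),
    ?_, fun t ↦ ?_, fun Q hQ ↦ ?_⟩
  · simp only [iteratedDeriv_succ]
    exact ((hGs.differentiable_iteratedDeriv i (by exact_mod_cast WithTop.coe_lt_top _)) t).hasDerivAt
  · have hb : ∀ i, ∃ C, ∀ t, |iteratedDeriv i G t| ≤ C := by
      intro i
      have hcs : HasCompactSupport (iteratedDeriv i G) :=
        isCompact_Icc.of_isClosed_subset (isClosed_tsupport _) (hsuppi i)
      exact hcs.exists_bound_of_continuous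
        (hGs.continuous_iteratedDeriv i (by exact_mod_cast le_top))
    choose C hC using hb
    refine ⟨∑ i ∈ Finset.range 5, |C i|, fun i hi t ↦ (hC i t).trans ((le_abs_self _).trans ?_)⟩
    exact Finset.single_le_sum (f := fun i ↦ |C i|) (fun _ _ ↦ abs_nonneg _)
      (Finset.mem_range.2 (by omega))
  · rcases le_or_gt t 0 with ht | ht
    · simp [hG0 t (by linarith)]
    · simp only [iteratedDeriv_zero]
      exact mul_nonneg (sub_nonneg.2 (hθm (by linarith))) (by positivity)
  · simp only [iteratedDeriv_zero]
    rcases le_or_gt Q 0 with hQ0 | hQ0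
    · have : ∀ n : ℕ, G (2 ^ n * Q) = 0 := fun n ↦ hG0 _ (by
        have : (2 : ℝ) ^ n * Q ≤ 0 := mul_nonpos_of_nonneg_of_nonpos (by positivity) hQ0
        linarith)
      simp only [this, mul_zero, max_eq_right hQ0, Real.zero_rpow hlam.ne']
      exact hasSum_zero
    · have hterm : ∀ n : ℕ, ((2 ^ n : ℝ)⁻¹) ^ lam * G (2 ^ n * Q) =
          Q ^ lam * (θ (2 ^ (n + 1) * Q) - θ (2 ^ n * Q)) := by
        intro n
        simp only [hG]
        rw [Real.mul_rpow (by positivity) hQ0.le, Real.inv_rpow (by positivity), pow_succ,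
          show 2 * (2 ^ n * Q) = 2 ^ n * 2 * Q by ring]
        have : ((2 : ℝ) ^ n) ^ lam ≠ 0 := by positivity
        field_simp
      simp only [hterm, max_eq_left hQ0.le]
      have htel : HasSum (fun n : ℕ ↦ θ (2 ^ (n + 1) * Q) - θ (2 ^ n * Q)) 1 := by
        rw [hasSum_iff_tendsto_nat_of_nonneg]
        · simp only [Finset.sum_range_sub (fun n : ℕ ↦ θ (2 ^ n * Q)), pow_zero, one_mul,
            hθ0 Q hQ, sub_zero]
          refine tendsto_const_nhds.congr' ?_
          have h2 : Filter.Tendsto (fun n : ℕ ↦ (2 : ℝ) ^ n * Q) Filter.atTop Filter.atTop :=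
            (tendsto_pow_atTop_atTop_of_one_lt one_lt_two).atTop_mul_const hQ0
          filter_upwards [h2.eventually_ge_atTop 2] with n hn using (hθ1 _ hn).symm
        · intro n
          refine sub_nonneg.2 (hθm ?_)
          rw [pow_succ]
          nlinarith [mul_pos (show (0 : ℝ) < 2 ^ n by positivity) hQ0]
      simpa using htel.mul_left (Q ^ lam)

/-- The annulus where `1 - u² - v²` is comparable to `δ` has area `O(δ)`. -/
theorem volume_annulus_le {δ : ℝ} (hδ : 0 < δ) (hδ1 : δ ≤ 1) :
    volume {p : ℝ × ℝ | 1 - p.1 ^ 2 - p.2 ^ 2 ∈ Icc (δ / 2) (2 * δ)} ≤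
      ENNReal.ofReal (2 * Real.pi * δ) := by
  set r := √(max (1 - 2 * δ) 0) with hr
  set R := √(1 - δ / 2) with hR
  have hr2 : r ^ 2 = max (1 - 2 * δ) 0 := Real.sq_sqrt (le_max_right _ _)
  have hR2 : R ^ 2 = 1 - δ / 2 := Real.sq_sqrt (by linarith)
  have hr0 : 0 ≤ r := Real.sqrt_nonneg _
  have hR0 : 0 ≤ R := Real.sqrt_nonneg _
  have hrR : r ≤ R := Real.sqrt_le_sqrt (max_le (by linarith) (by linarith))
  rw [← Complex.volume_preserving_equiv_real_prod.measure_preimage_equiv]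
  have hsub : Complex.measurableEquivRealProd ⁻¹'
      {p : ℝ × ℝ | 1 - p.1 ^ 2 - p.2 ^ 2 ∈ Icc (δ / 2) (2 * δ)} ⊆
      Metric.closedBall 0 R \ Metric.ball 0 r := by
    intro z hz
    simp only [mem_preimage, mem_ofPred_eq, Complex.measurableEquivRealProd_apply, mem_Icc] at hz
    have hn : ‖z‖ ^ 2 = z.re ^ 2 + z.im ^ 2 := by
      rw [Complex.sq_norm, Complex.normSq_apply]
      ring
    refine ⟨?_, ?_⟩
    · rw [mem_closedBall_zero_iff]
      exact abs_le_of_sq_le_sq' (by rw [hn, hR2]; linarith [hz.1]) hR0 |>.2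
    · rw [mem_ball_zero_iff, not_lt]
      refine abs_le_of_sq_le_sq' ?_ (norm_nonneg z) |>.2
      rw [hn, hr2]
      exact max_le (by linarith [hz.2]) (by positivity)
  refine (measure_mono hsub).trans ?_
  rw [measure_sdiff ((Metric.ball_subset_ball hrR).trans Metric.ball_subset_closedBall)
    measurableSet_ball.nullMeasurableSet measure_ball_lt_top.ne, Complex.volume_closedBall,
    Complex.volume_ball, ← ENNReal.ofReal_pow hR0, ← ENNReal.ofReal_pow hr0, hR2, hr2]
  have hpi : ((NNReal.pi : NNReal) : ℝ≥0∞) = ENNReal.ofReal Real.pi := by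
    rw [← NNReal.coe_real_pi, ENNReal.ofReal_coe_nnreal]
  rw [hpi, ← ENNReal.ofReal_mul (by linarith), ← ENNReal.ofReal_mul (le_max_right _ _),
    ← ENNReal.ofReal_sub _ (by positivity)]
  refine ENNReal.ofReal_le_ofReal ?_
  have : 1 - 2 * δ ≤ max (1 - 2 * δ) 0 := le_max_left _ _
  nlinarith [Real.pi_pos]

/-! ### Estimates for the dyadic pieces -/

/-- Continuous functions on the plane that are bounded by `κ` and supported where `1 - u² - v²` is
comparable to `δ`. -/
structure IsAnnular (δ κ : ℝ) (N : ℝ → ℝ → ℂ) : Prop where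
  continuous : Continuous (Function.uncurry N)
  bound : ∀ u v, ‖N u v‖ ≤ κ
  support : ∀ u v, N u v ≠ 0 → 1 - u ^ 2 - v ^ 2 ∈ Icc (δ / 2) (2 * δ)

namespace IsAnnular

variable {δ κ : ℝ} {N : ℝ → ℝ → ℂ}

theorem mem_square (hN : IsAnnular δ κ N) (hδ : 0 < δ) {u v : ℝ} (h : N u v ≠ 0) :
    u ∈ Icc (-1 : ℝ) 1 ∧ v ∈ Icc (-1 : ℝ) 1 := by
  have := (hN.support u v h).1
  exact ⟨abs_le.1 (abs_le_of_sq_le_sq (by nlinarith [sq_nonneg v]) zero_le_one),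
    abs_le.1 (abs_le_of_sq_le_sq (by nlinarith [sq_nonneg u]) zero_le_one)⟩

theorem isSquareBounded (hN : IsAnnular δ κ N) (hδ : 0 < δ) : IsSquareBounded N :=
  ⟨hN.continuous.measurable, ⟨κ, hN.bound⟩, fun _ _ h ↦ hN.mem_square hδ h⟩

theorem integrable_left (hN : IsAnnular δ κ N) (hδ : 0 < δ) (v : ℝ) :
    Integrable (fun u ↦ N u v) volume :=
  (hN.isSquareBounded hδ).swap.integrable_right v

theorem lintegral_le (hN : IsAnnular δ κ N) (hδ : 0 < δ) (hδ1 : δ ≤ 1) :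
    ∫⁻ u, ∫⁻ v, ‖N u v‖ₑ ≤ ENNReal.ofReal (κ * (2 * Real.pi * δ)) := by
  have hκ : 0 ≤ κ := (norm_nonneg _).trans (hN.bound 0 0)
  set S := {p : ℝ × ℝ | 1 - p.1 ^ 2 - p.2 ^ 2 ∈ Icc (δ / 2) (2 * δ)} with hS
  have hSm : MeasurableSet S := measurableSet_Icc.preimage (by fun_prop)
  rw [← lintegral_prod (fun p : ℝ × ℝ ↦ ‖N p.1 p.2‖ₑ)
    hN.continuous.measurable.enorm.aemeasurable, ENNReal.ofReal_mul hκ]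
  calc ∫⁻ p : ℝ × ℝ, ‖N p.1 p.2‖ₑ ≤ ∫⁻ p, S.indicator (fun _ ↦ ENNReal.ofReal κ) p := by
        refine lintegral_mono fun p ↦ ?_
        by_cases hp : p ∈ S
        · rw [indicator_of_mem hp, ← ofReal_norm]
          exact ENNReal.ofReal_le_ofReal (hN.bound _ _)
        · have : N p.1 p.2 = 0 := by
            by_contra h
            exact hp (hN.support _ _ h)
          simp [this]
    _ = ENNReal.ofReal κ * volume S := by rw [lintegral_indicator hSm, setLIntegral_const]
    _ ≤ _ := by
      gcongr
      exact volume_annulus_le hδ hδ1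

theorem add {κ' : ℝ} {N' : ℝ → ℝ → ℂ} (hN : IsAnnular δ κ N) (hN' : IsAnnular δ κ' N') :
    IsAnnular δ (κ + κ') fun u v ↦ N u v + N' u v where
  continuous := hN.continuous.add hN'.continuous
  bound u v := (norm_add_le _ _).trans (add_le_add (hN.bound u v) (hN'.bound u v))
  support u v h := by
    by_cases h0 : N u v = 0
    · exact hN'.support u v (by simpa [h0] using h)
    · exact hN.support u v h0

/-- A factor only has to be bounded on the square `[-1, 1]²`. -/
theorem mul_left (hN : IsAnnular δ κ N) (hδ : 0 < δ) {c : ℝ → ℝ → ℂ}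
    (hc : Continuous (Function.uncurry c)) {b κ' : ℝ}
    (hb : ∀ u ∈ Icc (-1 : ℝ) 1, ∀ v ∈ Icc (-1 : ℝ) 1, ‖c u v‖ ≤ b) (hκ' : b * κ ≤ κ') :
    IsAnnular δ κ' fun u v ↦ c u v * N u v where
  continuous := hc.mul hN.continuous
  bound u v := by
    have h0 : (0 : ℝ) ∈ Icc (-1 : ℝ) 1 := by norm_num
    have hb0 : 0 ≤ b := (norm_nonneg _).trans (hb 0 h0 0 h0)
    have hκ : 0 ≤ κ := (norm_nonneg _).trans (hN.bound 0 0)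
    refine le_trans ?_ hκ'
    rcases eq_or_ne (N u v) 0 with h | h
    · rw [h, mul_zero, norm_zero]
      positivity
    · obtain ⟨hu, hv⟩ := hN.mem_square hδ h
      rw [norm_mul]
      exact mul_le_mul (hb u hu v hv) (hN.bound u v) (norm_nonneg _) hb0
  support u v h := hN.support u v (right_ne_zero_of_mul h)

theorem mono {κ' : ℝ} (hN : IsAnnular δ κ N) (h : κ ≤ κ') : IsAnnular δ κ' N :=
  ⟨hN.continuous, fun u v ↦ (hN.bound u v).trans h, hN.support⟩

end IsAnnular

/-- If the derivatives `∂ᵤⁱ∂ᵥʲN`, `i, j ∈ {0, 2}`, of a function `N` supported at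
distance about `δ` from the unit circle obey the bounds dictated by that scale, then its slope
average has `L¹` norm `O(κ / δ)`: the area of the support is `O(δ)`, and the two frequency
variables each lose a factor `δ⁻¹`. -/
theorem IsAnnular.lintegral_tensor_le {δ κ : ℝ} {P P' Φ : 𝓢(ℝ, ℂ)}
    (hP : ∀ s, HasDerivAt P (P' s) s) (hP' : ∀ s, HasDerivAt P' (Φ s) s)
    {N Nu Nuu Nv Nvv Nuuv Nuuvv : ℝ → ℝ → ℂ} (hδ : 0 < δ) (hδ1 : δ ≤ 1)
    (hN : IsAnnular δ κ N)
    (hNu : ∃ κ', IsAnnular δ κ' Nu) (hNuu : IsAnnular δ (κ * (δ⁻¹) ^ 2) Nuu)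
    (hNv : ∃ κ', IsAnnular δ κ' Nv) (hNvv : IsAnnular δ (κ * (δ⁻¹) ^ 2) Nvv)
    (hNuuv : ∃ κ', IsAnnular δ κ' Nuuv) (hNuuvv : IsAnnular δ (κ * (δ⁻¹) ^ 4) Nuuvv)
    (du : ∀ u v, HasDerivAt (fun u ↦ N u v) (Nu u v) u)
    (duu : ∀ u v, HasDerivAt (fun u ↦ Nu u v) (Nuu u v) u)
    (dv : ∀ u v, HasDerivAt (N u) (Nv u v) v) (dvv : ∀ u v, HasDerivAt (Nv u) (Nvv u v) v)
    (duuv : ∀ u v, HasDerivAt (Nuu u) (Nuuv u v) v)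
    (duuvv : ∀ u v, HasDerivAt (Nuuv u) (Nuuvv u v) v) :
    ∫⁻ q : ℝ × ℝ, ∫⁻ p : ℝ × ℝ,
        ‖∫ u, (∫ v, N u v * Φ (q.2 + v * q.1)) * Φ (p.2 + u * p.1)‖ₑ ≤
      ((∫⁻ s, ‖Φ s‖ₑ) + ∫⁻ s, ‖P s‖ₑ) ^ 2 *
        ENNReal.ofReal (8 * Real.pi ^ 3 * (κ * δ⁻¹)) := by
  obtain ⟨_, hNu⟩ := hNu
  obtain ⟨_, hNv⟩ := hNv
  obtain ⟨_, hNuuv⟩ := hNuuv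
  have hκ : 0 ≤ κ := (norm_nonneg _).trans (hN.bound 0 0)
  have hpi := Real.pi_pos
  have iN := fun u ↦ (hN.isSquareBounded hδ).integrable_right u
  have iNv := fun u ↦ (hNv.isSquareBounded hδ).integrable_right u
  have iNvv := fun u ↦ (hNvv.isSquareBounded hδ).integrable_right u
  have iNuu := fun u ↦ (hNuu.isSquareBounded hδ).integrable_right u
  have iNuuv := fun u ↦ (hNuuv.isSquareBounded hδ).integrable_right u
  have iNuuvv := fun u ↦ (hNuuvv.isSquareBounded hδ).integrable_right u
  refine (lintegral_slope_average_tensor_le (P := P) (hN.isSquareBounded hδ)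
    (hNuu.isSquareBounded hδ) (hNvv.isSquareBounded hδ) (hNuuvv.isSquareBounded hδ)
    (fun v y₀ y₁ ↦ sq_mul_integral_mul_profile hP hP' (fun u ↦ du u v) (fun u ↦ duu u v)
      (hN.integrable_left hδ v) (hNu.integrable_left hδ v) (hNuu.integrable_left hδ v) y₀ y₁)
    (fun u z₀ z₁ ↦ sq_mul_integral_mul_profile hP hP' (dv u) (dvv u) (iN u) (iNv u) (iNvv u) z₀ z₁)
    (fun u z₀ z₁ ↦ sq_mul_integral_mul_profile hP hP' (duuv u) (duuvv u) (iNuu u) (iNuuv u)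
      (iNuuvv u) z₀ z₁) hδ).trans ?_
  set A := (∫⁻ s, ‖Φ s‖ₑ) + ∫⁻ s, ‖P s‖ₑ
  rw [mul_pow, mul_comm (_ ^ 2) (A ^ 2), mul_assoc]
  gcongr
  calc _ ≤ ENNReal.ofReal (Real.pi / δ) ^ 2 *
        ((ENNReal.ofReal (κ * (2 * Real.pi * δ)) +
          ENNReal.ofReal (δ ^ 2) * ENNReal.ofReal (κ * δ⁻¹ ^ 2 * (2 * Real.pi * δ))) +
          ENNReal.ofReal (δ ^ 2) * (ENNReal.ofReal (κ * δ⁻¹ ^ 2 * (2 * Real.pi * δ)) +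
            ENNReal.ofReal (δ ^ 2) * ENNReal.ofReal (κ * δ⁻¹ ^ 4 * (2 * Real.pi * δ)))) := by
        gcongr
        · exact hN.lintegral_le hδ hδ1
        · exact hNvv.lintegral_le hδ hδ1
        · exact hNuu.lintegral_le hδ hδ1
        · exact hNuuvv.lintegral_le hδ hδ1
    _ = _ := by
      rw [← ENNReal.ofReal_pow (by positivity), ← ENNReal.ofReal_mul (by positivity),
        ← ENNReal.ofReal_mul (by positivity), ← ENNReal.ofReal_add (by positivity) (by positivity),
        ← ENNReal.ofReal_add (by positivity) (by positivity), ← ENNReal.ofReal_mul (by positivity),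
        ← ENNReal.ofReal_add (by positivity) (by positivity), ← ENNReal.ofReal_mul (by positivity)]
      congr 1
      field_simp
      ring

section Piece

variable {lam δ B L : ℝ} {g : ℕ → ℝ → ℝ} {Ψ Ψ₁ Ψ₂ : ℝ → ℂ}

/-- The `i`-th derivative of the dyadic piece `t ↦ δ ^ lam g(t / δ)` of `t₊ ^ lam`, at
`t = 1 - u² - v²`; here `g i` stands for the `i`-th derivative of `g`. -/
noncomputable def annularFactor (lam δ : ℝ) (g : ℕ → ℝ → ℝ) (i : ℕ) (u v : ℝ) : ℂ :=
  ((δ ^ lam * δ⁻¹ ^ i * g i (δ⁻¹ * (1 - u ^ 2 - v ^ 2)) : ℝ) : ℂ)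

theorem hasDerivAt_annularFactor_left (hg : ∀ i t, HasDerivAt (g i) (g (i + 1) t) t) (i : ℕ)
    (u v : ℝ) : HasDerivAt (fun u ↦ annularFactor lam δ g i u v)
      (-2 * u * annularFactor lam δ g (i + 1) u v) u := by
  have h1 : HasDerivAt (fun u : ℝ ↦ δ⁻¹ * (1 - u ^ 2 - v ^ 2)) (δ⁻¹ * (-(2 * u))) u := by
    simpa using ((((hasDerivAt_id u).pow 2).const_sub 1).sub_const (v ^ 2)).const_mul δ⁻¹
  have h2 := (((hg i _).comp u h1).const_mul (δ ^ lam * δ⁻¹ ^ i)).ofReal_comp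
  refine h2.congr_deriv ?_
  simp only [annularFactor]
  push_cast
  ring

theorem annularFactor_comm (i : ℕ) (u v : ℝ) :
    annularFactor lam δ g i u v = annularFactor lam δ g i v u := by
  simp only [annularFactor, sub_right_comm]

theorem hasDerivAt_annularFactor_right (hg : ∀ i t, HasDerivAt (g i) (g (i + 1) t) t) (i : ℕ)
    (u v : ℝ) : HasDerivAt (annularFactor lam δ g i u)
      (-2 * v * annularFactor lam δ g (i + 1) u v) v := by
  have h := hasDerivAt_annularFactor_left (lam := lam) (δ := δ) hg i v u
  simpa only [annularFactor_comm _ _ u] using h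

theorem isAnnular_annularFactor (hg : ∀ i t, HasDerivAt (g i) (g (i + 1) t) t)
    (hgs : ∀ i t, g i t ≠ 0 → t ∈ Icc (1 / 2 : ℝ) 2) {G : ℝ} (hgb : ∀ i ≤ 4, ∀ t, |g i t| ≤ G)
    (hδ : 0 < δ) {i : ℕ} (hi : i ≤ 4) :
    IsAnnular δ (G * δ ^ lam * δ⁻¹ ^ i) (annularFactor lam δ g i) where
  continuous := by
    have : Continuous (g i) := continuous_iff_continuousAt.2 fun t ↦ (hg i t).continuousAt
    unfold annularFactor Function.uncurry
    fun_prop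
  bound u v := by
    rw [annularFactor, Complex.norm_real, Real.norm_eq_abs, abs_mul, abs_of_nonneg (by positivity),
      show G * δ ^ lam * δ⁻¹ ^ i = δ ^ lam * δ⁻¹ ^ i * G by ring]
    exact mul_le_mul_of_nonneg_left (hgb i hi _) (by positivity)
  support u v h := by
    have h1 : g i (δ⁻¹ * (1 - u ^ 2 - v ^ 2)) ≠ 0 := by
      intro h0
      exact h (by simp [annularFactor, h0])
    obtain ⟨h2, h3⟩ := hgs i _ h1
    rw [inv_mul_eq_div] at h2 h3
    rw [le_div_iff₀ hδ] at h2
    rw [div_le_iff₀ hδ] at h3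
    exact ⟨by linarith, h3⟩

/-- A cutoff in the slope `u`, localizing to `1 - u² ≤ 2 / L` and varying at scale `1 / L` on
`[-1, 1]`, together with its first two derivatives. -/
structure IsSlopeCutoff (B L : ℝ) (Ψ Ψ₁ Ψ₂ : ℝ → ℂ) : Prop where
  hasDerivAt : ∀ u, HasDerivAt Ψ (Ψ₁ u) u
  hasDerivAt_one : ∀ u, HasDerivAt Ψ₁ (Ψ₂ u) u
  continuous_two : Continuous Ψ₂
  bound : ∀ u ∈ Icc (-1 : ℝ) 1, ‖Ψ u‖ ≤ B
  bound_one : ∀ u ∈ Icc (-1 : ℝ) 1, ‖Ψ₁ u‖ ≤ B * L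
  bound_two : ∀ u ∈ Icc (-1 : ℝ) 1, ‖Ψ₂ u‖ ≤ B * L ^ 2
  support : ∀ u ∈ Icc (-1 : ℝ) 1, Ψ u ≠ 0 → L * (1 - u ^ 2) ≤ 2

/-- `∂ᵤ²` of the product of the cutoff `Ψ(u)` and the `i`-th annular factor. -/
noncomputable def pieceSecondDeriv (lam δ : ℝ) (g : ℕ → ℝ → ℝ) (Ψ Ψ₁ Ψ₂ : ℝ → ℂ) (i : ℕ)
    (u v : ℝ) : ℂ :=
  Ψ₂ u * annularFactor lam δ g i u v + -4 * u * Ψ₁ u * annularFactor lam δ g (i + 1) u v +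
    (4 * u ^ 2 * Ψ u * annularFactor lam δ g (i + 2) u v +
      -2 * Ψ u * annularFactor lam δ g (i + 1) u v)

theorem hasDerivAt_pieceSecondDeriv_right (hg : ∀ i t, HasDerivAt (g i) (g (i + 1) t) t) (i : ℕ)
    (u v : ℝ) : HasDerivAt (pieceSecondDeriv lam δ g Ψ Ψ₁ Ψ₂ i u)
      (-2 * v * pieceSecondDeriv lam δ g Ψ Ψ₁ Ψ₂ (i + 1) u v) v := by
  have h := fun k ↦ hasDerivAt_annularFactor_right (lam := lam) (δ := δ) hg k u v
  refine ((((h i).const_mul (Ψ₂ u)).add ((h (i + 1)).const_mul (-4 * u * Ψ₁ u))).add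
    (((h (i + 2)).const_mul (4 * u ^ 2 * Ψ u)).add
      ((h (i + 1)).const_mul (-2 * Ψ u)))).congr_deriv ?_
  simp only [pieceSecondDeriv]
  ring

theorem IsSlopeCutoff.isAnnular_pieceSecondDeriv (hΨ : IsSlopeCutoff B L Ψ Ψ₁ Ψ₂)
    (hg : ∀ i t, HasDerivAt (g i) (g (i + 1) t) t)
    (hgs : ∀ i t, g i t ≠ 0 → t ∈ Icc (1 / 2 : ℝ) 2) {G : ℝ} (hgb : ∀ i ≤ 4, ∀ t, |g i t| ≤ G)
    (hB : 0 ≤ B) (hL : 0 ≤ L) (hδ : 0 < δ) (hδ1 : δ ≤ 1) (hLδ : L * δ ≤ 4) {i : ℕ} (hi : i ≤ 2) :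
    IsAnnular δ (38 * (B * (G * δ ^ lam)) * δ⁻¹ ^ (i + 2))
      (pieceSecondDeriv lam δ g Ψ Ψ₁ Ψ₂ i) := by
  have hG : 0 ≤ G := (abs_nonneg _).trans (hgb 0 (by norm_num) 0)
  have hL' : L ≤ 4 * δ⁻¹ := by rwa [← div_eq_mul_inv, le_div_iff₀ hδ]
  have hL2 : L ^ 2 ≤ (4 * δ⁻¹) ^ 2 := pow_le_pow_left₀ hL hL' 2
  have hδi : 1 ≤ δ⁻¹ := (one_le_inv₀ hδ).2 hδ1
  have c0 : Continuous Ψ := continuous_iff_continuousAt.2 fun u ↦ (hΨ.hasDerivAt u).continuousAt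
  have c1 : Continuous Ψ₁ :=
    continuous_iff_continuousAt.2 fun u ↦ (hΨ.hasDerivAt_one u).continuousAt
  have c2 := hΨ.continuous_two
  set K := G * δ ^ lam with hK
  have hK0 : 0 ≤ K := by positivity
  have h := fun k (hk : k ≤ 4) ↦ isAnnular_annularFactor (lam := lam) hg hgs hgb hδ hk
  have hpow : δ⁻¹ ^ (i + 2) = δ⁻¹ ^ i * δ⁻¹ ^ 2 := pow_add _ _ _
  have t0 := (h i (by omega)).mul_left hδ (c := fun u _ ↦ Ψ₂ u)
    (κ' := 16 * (B * K) * δ⁻¹ ^ (i + 2)) (by unfold Function.uncurry; fun_prop)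
    (fun u hu _ _ ↦ hΨ.bound_two u hu) (by
      calc B * L ^ 2 * (K * δ⁻¹ ^ i) ≤ B * (4 * δ⁻¹) ^ 2 * (K * δ⁻¹ ^ i) := by gcongr
        _ = _ := by rw [hpow]; ring)
  have t1 := (h (i + 1) (by omega)).mul_left hδ (c := fun u _ ↦ -4 * u * Ψ₁ u)
    (b := 4 * (B * L))
    (κ' := 16 * (B * K) * δ⁻¹ ^ (i + 2)) (by unfold Function.uncurry; fun_prop)
    (fun u hu _ _ ↦ by
      have hu1 : |u| ≤ 1 := abs_le.2 hu
      have := hΨ.bound_one u hu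
      rw [norm_mul, norm_mul, Complex.norm_real, Real.norm_eq_abs]
      norm_num
      nlinarith [mul_le_mul hu1 this (norm_nonneg _) zero_le_one]) (by
      calc 4 * (B * L) * (K * δ⁻¹ ^ (i + 1)) ≤ 4 * (B * (4 * δ⁻¹)) * (K * δ⁻¹ ^ (i + 1)) := by
            gcongr
        _ = _ := by rw [hpow, pow_succ]; ring)
  have t2 := (h (i + 2) (by omega)).mul_left hδ (c := fun u _ ↦ 4 * u ^ 2 * Ψ u)
    (b := 4 * B)
    (κ' := 4 * (B * K) * δ⁻¹ ^ (i + 2)) (by unfold Function.uncurry; fun_prop)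
    (fun u hu _ _ ↦ by
      have hu1 : |u| ^ 2 ≤ 1 := pow_le_one₀ (abs_nonneg u) (abs_le.2 hu)
      have := hΨ.bound u hu
      rw [norm_mul, norm_mul, norm_pow, Complex.norm_real, Real.norm_eq_abs]
      norm_num
      rw [sq_abs] at hu1
      nlinarith [mul_le_mul hu1 this (norm_nonneg _) zero_le_one]) (le_of_eq (by ring))
  have t3 := (h (i + 1) (by omega)).mul_left hδ (c := fun u _ ↦ -2 * Ψ u)
    (b := 2 * B)
    (κ' := 2 * (B * K) * δ⁻¹ ^ (i + 2)) (by unfold Function.uncurry; fun_prop)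
    (fun u hu _ _ ↦ by
      have := hΨ.bound u hu
      rw [norm_mul]
      norm_num
      exact this) (by
      calc 2 * B * (K * δ⁻¹ ^ (i + 1)) = 2 * (B * K) * δ⁻¹ ^ (i + 1) := by ring
        _ ≤ _ := by
          gcongr
          norm_num)
  exact ((t0.add t1).add (t2.add t3)).mono (le_of_eq (by ring))

/-- The slope average of one dyadic piece has `L¹` norm `O(δ ^ (lam - 1))`. -/
theorem IsSlopeCutoff.lintegral_piece_le {P P' Φ : 𝓢(ℝ, ℂ)}
    (hP : ∀ s, HasDerivAt P (P' s) s) (hP' : ∀ s, HasDerivAt P' (Φ s) s)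
    (hΨ : IsSlopeCutoff B L Ψ Ψ₁ Ψ₂)
    (hg : ∀ i t, HasDerivAt (g i) (g (i + 1) t) t)
    (hgs : ∀ i t, g i t ≠ 0 → t ∈ Icc (1 / 2 : ℝ) 2) {G : ℝ} (hgb : ∀ i ≤ 4, ∀ t, |g i t| ≤ G)
    (hB : 0 ≤ B) (hL : 0 ≤ L) (hδ : 0 < δ) (hδ1 : δ ≤ 1) (hLδ : L * δ ≤ 4) :
    ∫⁻ q : ℝ × ℝ, ∫⁻ p : ℝ × ℝ,
        ‖∫ u, (∫ v, Ψ u * annularFactor lam δ g 0 u v * Φ (q.2 + v * q.1)) *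
          Φ (p.2 + u * p.1)‖ₑ ≤
      ((∫⁻ s, ‖Φ s‖ₑ) + ∫⁻ s, ‖P s‖ₑ) ^ 2 *
        ENNReal.ofReal (8 * Real.pi ^ 3 * (228 * (B * (G * δ ^ lam)) * δ⁻¹)) := by
  have hG : 0 ≤ G := (abs_nonneg _).trans (hgb 0 (by norm_num) 0)
  have hδi : 1 ≤ δ⁻¹ := (one_le_inv₀ hδ).2 hδ1
  have c0 : Continuous Ψ := continuous_iff_continuousAt.2 fun u ↦ (hΨ.hasDerivAt u).continuousAt
  have c1 : Continuous Ψ₁ :=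
    continuous_iff_continuousAt.2 fun u ↦ (hΨ.hasDerivAt_one u).continuousAt
  set K := G * δ ^ lam with hK
  have hK0 : 0 ≤ K := by positivity
  have hBK : 0 ≤ B * K := by positivity
  have h := fun k (hk : k ≤ 4) ↦ isAnnular_annularFactor (lam := lam) hg hgs hgb hδ hk
  have hD := fun k (hk : k ≤ 2) ↦
    hΨ.isAnnular_pieceSecondDeriv (lam := lam) hg hgs hgb hB hL hδ hδ1 hLδ hk
  have hcΨ : ∀ k ≤ 4, IsAnnular δ (B * K * δ⁻¹ ^ k)
      (fun u v ↦ Ψ u * annularFactor lam δ g k u v) := fun k hk ↦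
    (h k hk).mul_left hδ (c := fun u _ ↦ Ψ u) (by unfold Function.uncurry; fun_prop)
      (fun u hu _ _ ↦ hΨ.bound u hu) (le_of_eq (by ring))
  have hcΨ₁ : IsAnnular δ (B * L * K)
      (fun u v ↦ Ψ₁ u * annularFactor lam δ g 0 u v) :=
    (h 0 (by omega)).mul_left hδ (c := fun u _ ↦ Ψ₁ u) (by unfold Function.uncurry; fun_prop)
      (fun u hu _ _ ↦ hΨ.bound_one u hu) (le_of_eq (by ring))
  have hlin : ∀ x ∈ Icc (-1 : ℝ) 1, ‖(-2 * x : ℂ)‖ ≤ 2 := by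
    intro x hx
    have hx1 : |x| ≤ 1 := abs_le.2 hx
    rw [norm_mul, Complex.norm_real, Real.norm_eq_abs]
    norm_num
    linarith
  have hquad : ∀ x ∈ Icc (-1 : ℝ) 1, ‖(4 * x ^ 2 : ℂ)‖ ≤ 4 := by
    intro x hx
    rw [norm_mul, norm_pow, Complex.norm_real, Real.norm_eq_abs]
    norm_num
    exact abs_le.2 hx
  have cu : Continuous (Function.uncurry fun (u _ : ℝ) ↦ (-2 * u : ℂ)) := by
    unfold Function.uncurry; fun_prop
  have cv : Continuous (Function.uncurry fun (_ v : ℝ) ↦ (-2 * v : ℂ)) := by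
    unfold Function.uncurry; fun_prop
  have cvv : Continuous (Function.uncurry fun (_ v : ℝ) ↦ (4 * v ^ 2 : ℂ)) := by
    unfold Function.uncurry; fun_prop
  have hconst : ∀ u ∈ Icc (-1 : ℝ) 1, ∀ v ∈ Icc (-1 : ℝ) 1, ‖(-2 : ℂ)‖ ≤ 2 := by
    intro u _ v _
    simp
  have hd := fun k u v ↦ hasDerivAt_annularFactor_left (lam := lam) (δ := δ) hg k u v
  have hd' := fun k u v ↦ hasDerivAt_annularFactor_right (lam := lam) (δ := δ) hg k u v
  have hlinear : ∀ v : ℝ, HasDerivAt (fun v : ℝ ↦ (-2 * v : ℂ)) (-2) v := fun v ↦ by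
    simpa using (HasDerivAt.ofReal_comp (hasDerivAt_id v)).const_mul (-2 : ℂ)
  refine IsAnnular.lintegral_tensor_le hP hP' hδ hδ1
    (N := fun u v ↦ Ψ u * annularFactor lam δ g 0 u v)
    (Nu := fun u v ↦ Ψ₁ u * annularFactor lam δ g 0 u v +
      (-2 * u) * (Ψ u * annularFactor lam δ g 1 u v))
    (Nuu := pieceSecondDeriv lam δ g Ψ Ψ₁ Ψ₂ 0)
    (Nv := fun u v ↦ (-2 * v) * (Ψ u * annularFactor lam δ g 1 u v))
    (Nvv := fun u v ↦ (-2) * (Ψ u * annularFactor lam δ g 1 u v) +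
      (4 * v ^ 2) * (Ψ u * annularFactor lam δ g 2 u v))
    (Nuuv := fun u v ↦ (-2 * v) * pieceSecondDeriv lam δ g Ψ Ψ₁ Ψ₂ 1 u v)
    (Nuuvv := fun u v ↦ (-2) * pieceSecondDeriv lam δ g Ψ Ψ₁ Ψ₂ 1 u v +
      (4 * v ^ 2) * pieceSecondDeriv lam δ g Ψ Ψ₁ Ψ₂ 2 u v)
    ?_ ?_ ?_ ?_ ?_ ?_ ?_ ?_ ?_ ?_ ?_ ?_ ?_
  · exact (hcΨ 0 (by omega)).mono (by rw [pow_zero]; linarith)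
  · exact ⟨_, hcΨ₁.add ((hcΨ 1 (by omega)).mul_left hδ cu (fun u hu _ _ ↦ hlin u hu) le_rfl)⟩
  · exact (hD 0 (by omega)).mono (by gcongr; norm_num)
  · exact ⟨_, (hcΨ 1 (by omega)).mul_left hδ cv (fun _ _ v hv ↦ hlin v hv) le_rfl⟩
  · refine (((hcΨ 1 (by omega)).mul_left hδ (by unfold Function.uncurry; fun_prop) hconst
      le_rfl).add ((hcΨ 2 (by omega)).mul_left hδ cvv (fun _ _ v hv ↦ hquad v hv) le_rfl)).mono ?_
    have : B * K * δ⁻¹ ^ 1 ≤ B * K * δ⁻¹ ^ 2 := by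
      gcongr
      norm_num
    nlinarith [show 0 ≤ B * K * δ⁻¹ ^ 2 by positivity]
  · exact ⟨_, (hD 1 (by omega)).mul_left hδ cv (fun _ _ v hv ↦ hlin v hv) le_rfl⟩
  · refine (((hD 1 (by omega)).mul_left hδ (by unfold Function.uncurry; fun_prop) hconst
      le_rfl).add ((hD 2 (by omega)).mul_left hδ cvv (fun _ _ v hv ↦ hquad v hv) le_rfl)).mono ?_
    have : 38 * (B * K) * δ⁻¹ ^ (1 + 2) ≤ 38 * (B * K) * δ⁻¹ ^ 4 := by
      gcongr
      norm_num
    norm_num at this ⊢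
    linarith
  · intro u v
    refine ((hΨ.hasDerivAt u).mul (hd 0 u v)).congr_deriv ?_
    ring
  · intro u v
    refine (((hΨ.hasDerivAt_one u).mul (hd 0 u v)).add
      ((hlinear u).mul ((hΨ.hasDerivAt u).mul (hd 1 u v)))).congr_deriv ?_
    simp only [pieceSecondDeriv, Pi.mul_apply]
    ring
  · intro u v
    refine ((hd' 0 u v).const_mul (Ψ u)).congr_deriv ?_
    ring
  · intro u v
    refine ((hlinear v).mul ((hd' 1 u v).const_mul (Ψ u))).congr_deriv ?_
    ring
  · intro u v
    exact hasDerivAt_pieceSecondDeriv_right hg 0 u v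
  · intro u v
    refine ((hlinear v).mul (hasDerivAt_pieceSecondDeriv_right hg 1 u v)).congr_deriv ?_
    ring

end Piece

/-! ### Summation over the dyadic pieces -/

section Summation

theorem integral_integral_eq_integral_prod {N : ℝ → ℝ → ℂ} (hN : IsSquareBounded N) (Φ : 𝓢(ℝ, ℂ))
    (p q : ℝ × ℝ) :
    ∫ u, (∫ v, N u v * Φ (q.2 + v * q.1)) * Φ (p.2 + u * p.1) =
      ∫ r : ℝ × ℝ, N r.1 r.2 * (Φ (q.2 + r.2 * q.1) * Φ (p.2 + r.1 * p.1)) := by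
  have hΦm := Φ.continuous.measurable
  have h1 := (hN.mul_left hΦm Φ.exists_norm_le (w := fun r ↦ q.2 + r.2 * q.1)
    (by fun_prop)).mul_left hΦm Φ.exists_norm_le (w := fun r ↦ p.2 + r.1 * p.1) (by fun_prop)
  simp_rw [← integral_mul_const]
  rw [integral_integral h1.integrable, Measure.volume_eq_prod]
  simp_rw [mul_assoc]

/-- Slope averages are countably subadditive over series of functions of constant phase, for which
absolute summability comes for free from the integrability of the sum. -/
theorem enorm_slope_average_le_tsum {M : ℝ → ℝ → ℂ} {N : ℕ → ℝ → ℝ → ℂ} (hM : IsSquareBounded M)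
    (hN : ∀ n, IsSquareBounded (N n)) (hsum : ∀ u v, HasSum (fun n ↦ N n u v) (M u v))
    (hnorm : ∀ u v, ∑' n, ‖N n u v‖ₑ = ‖M u v‖ₑ) (Φ : 𝓢(ℝ, ℂ)) (p q : ℝ × ℝ) :
    ‖∫ u, (∫ v, M u v * Φ (q.2 + v * q.1)) * Φ (p.2 + u * p.1)‖ₑ ≤
      ∑' n, ‖∫ u, (∫ v, N n u v * Φ (q.2 + v * q.1)) * Φ (p.2 + u * p.1)‖ₑ := by
  have hΦm := Φ.continuous.measurable
  have hMi := (hM.mul_left hΦm Φ.exists_norm_le (w := fun r ↦ q.2 + r.2 * q.1)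
    (by fun_prop)).mul_left hΦm Φ.exists_norm_le (w := fun r ↦ p.2 + r.1 * p.1) (by fun_prop)
  set W : ℝ × ℝ → ℂ := fun r ↦ Φ (q.2 + r.2 * q.1) * Φ (p.2 + r.1 * p.1) with hW
  have hWm : Measurable W := by
    rw [hW]
    fun_prop
  have hNm : ∀ n, Measurable fun r : ℝ × ℝ ↦ N n r.1 r.2 := fun n ↦ (hN n).measurable
  have hprod : ∀ n, Measurable fun r : ℝ × ℝ ↦ N n r.1 r.2 * W r := fun n ↦ (hNm n).mul hWm
  have htsum : ∀ r : ℝ × ℝ, M r.1 r.2 * W r = ∑' n, N n r.1 r.2 * W r := fun r ↦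
    ((hsum r.1 r.2).mul_right (W r)).tsum_eq.symm
  have hfin : ∑' n, ∫⁻ r : ℝ × ℝ, ‖N n r.1 r.2 * W r‖ₑ ≠ ⊤ := by
    rw [← lintegral_tsum fun n ↦ (hprod n).enorm.aemeasurable]
    have : ∀ r : ℝ × ℝ, ∑' n, ‖N n r.1 r.2 * W r‖ₑ = ‖M r.1 r.2 * W r‖ₑ := by
      intro r
      simp only [enorm_mul]
      rw [ENNReal.tsum_mul_right, hnorm]
    simp_rw [this]
    have h2 : Integrable (fun r : ℝ × ℝ ↦ M r.1 r.2 * W r) (volume.prod volume) := by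
      refine hMi.integrable.congr (Filter.Eventually.of_forall fun r ↦ ?_)
      simp only [Function.uncurry, hW]
      ring
    exact h2.2.ne
  simp_rw [integral_integral_eq_integral_prod hM,
    fun n ↦ integral_integral_eq_integral_prod (hN n) Φ]
  change ‖∫ r : ℝ × ℝ, M r.1 r.2 * W r‖ₑ ≤ ∑' n, ‖∫ r : ℝ × ℝ, N n r.1 r.2 * W r‖ₑ
  simp_rw [htsum]
  rw [integral_tsum (fun n ↦ (hprod n).aestronglyMeasurable) hfin]
  exact enorm_tsum_le_tsum_enorm

theorem lintegral_plane_prod {H : ℝ × ℝ → ℝ × ℝ → ℝ≥0∞} (hH : Measurable (Function.uncurry H)) :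
    ∫⁻ w : Plane × Plane, H (w.1 0, w.1 1) (w.2 0, w.2 1) = ∫⁻ q, ∫⁻ p, H p q := by
  have hm : Measurable fun w : Plane × Plane ↦ H (w.1 0, w.1 1) (w.2 0, w.2 1) :=
    hH.comp (by fun_prop : Measurable fun w : Plane × Plane ↦ ((w.1 0, w.1 1), (w.2 0, w.2 1)))
  rw [Measure.volume_eq_prod, lintegral_prod_symm' _ hm,
    ← planeCoords_measurePreserving.lintegral_comp hH.lintegral_prod_left]
  refine lintegral_congr fun z ↦ ?_
  exact planeCoords_measurePreserving.lintegral_comp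
    (f := fun p ↦ H p (z 0, z 1)) (hH.comp measurable_prodMk_right)

variable {lam B L : ℝ} {Ψ Ψ₁ Ψ₂ : ℝ → ℂ}

theorem max_rpow_ne_zero_mem (hlam : 0 < lam) {u v : ℝ}
    (h : max (1 - u ^ 2 - v ^ 2) 0 ^ lam ≠ 0) :
    u ∈ Icc (-1 : ℝ) 1 ∧ v ∈ Icc (-1 : ℝ) 1 := by
  have hQ : 0 < 1 - u ^ 2 - v ^ 2 := by
    by_contra h0
    exact h (by rw [max_eq_right (not_lt.1 h0), Real.zero_rpow hlam.ne'])
  exact ⟨abs_le.1 (abs_le_of_sq_le_sq (by nlinarith [sq_nonneg v]) zero_le_one),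
    abs_le.1 (abs_le_of_sq_le_sq (by nlinarith [sq_nonneg u]) zero_le_one)⟩

theorem IsSlopeCutoff.continuous (hΨ : IsSlopeCutoff B L Ψ Ψ₁ Ψ₂) : Continuous Ψ :=
  continuous_iff_continuousAt.2 fun u ↦ (hΨ.hasDerivAt u).continuousAt

theorem IsSlopeCutoff.isSquareBounded (hlam : 0 < lam) (hΨ : IsSlopeCutoff B L Ψ Ψ₁ Ψ₂) :
    IsSquareBounded fun u v ↦ Ψ u * ((max (1 - u ^ 2 - v ^ 2) 0 ^ lam : ℝ) : ℂ) where
  measurable := by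
    have := hΨ.continuous
    have h2 : Continuous fun p : ℝ × ℝ ↦ max (1 - p.1 ^ 2 - p.2 ^ 2) 0 ^ lam :=
      Continuous.rpow_const (by fun_prop) fun _ ↦ Or.inr hlam.le
    exact ((this.comp continuous_fst).mul (Complex.continuous_ofReal.comp h2)).measurable
  bounded := by
    refine ⟨B, fun u v ↦ ?_⟩
    have hB : 0 ≤ B := (norm_nonneg _).trans (hΨ.bound 0 (by norm_num))
    rcases eq_or_ne (max (1 - u ^ 2 - v ^ 2) 0 ^ lam) 0 with h | h
    · simpa [h] using hB
    · rw [norm_mul, Complex.norm_real, Real.norm_eq_abs, abs_of_nonneg (by positivity)]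
      refine (mul_le_mul (hΨ.bound u (max_rpow_ne_zero_mem hlam h).1)
        (Real.rpow_le_one (le_max_right _ _) (max_le ?_ zero_le_one) hlam.le) (by positivity)
        hB).trans_eq (mul_one B)
      nlinarith [sq_nonneg u, sq_nonneg v]
  support u v h := max_rpow_ne_zero_mem hlam (by simpa using right_ne_zero_of_mul h)

/-- The kernel of the multiplier `Ψ(u) (1 - u² - v²)₊ ^ lam` in the slopes `u, v`, with `Ψ` localizing
to `1 - u² ≲ 1 / L`, has `L¹` norm `O(L ^ (-(lam - 1) / 2))`. -/
theorem exists_lintegral_bilinearKernel_le {φ : ℝ → ℂ} (hφ : IsDyadicBump φ) (hlam : 1 < lam)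
    (hB : 0 ≤ B) :
    ∃ C : ℝ, 0 < C ∧ ∀ (L : ℝ) (Ψ Ψ₁ Ψ₂ : ℝ → ℂ), 0 < L → IsSlopeCutoff B L Ψ Ψ₁ Ψ₂ →
      ∫⁻ w : Plane × Plane, ‖bilinearKernel (fun ξ η ↦
        Ψ (ξ 0 / ξ 1) * ((max (1 - (ξ 0 / ξ 1) ^ 2 - (η 0 / η 1) ^ 2) 0 ^ lam : ℝ) : ℂ) *
          φ (ξ 1) * φ (η 1)) w.1 w.2‖ₑ ≤ ENNReal.ofReal (C * L ^ (-((lam - 1) / 2))) := by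
  have hlam0 : 0 < lam := by linarith
  obtain ⟨P, P', Φ, hP, hP', hΦ⟩ := hφ.exists_profile
  obtain ⟨g, hg, hgs, ⟨G, hgb⟩, hg0, hgsum⟩ := exists_dyadic_rpow hlam0
  have hG : 0 ≤ G := (abs_nonneg _).trans (hgb 0 (by norm_num) 0)
  set ε := (lam - 1) / 2 with hε
  have hε0 : 0 < ε := by rw [hε]; linarith
  set A := (∫⁻ s, ‖Φ s‖ₑ) + ∫⁻ s, ‖P s‖ₑ with hA
  have hAfin : A ≠ ⊤ := ENNReal.add_ne_top.2
    ⟨(Φ.integrable (μ := volume)).2.ne, (P.integrable (μ := volume)).2.ne⟩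
  have hgeom : Summable fun n : ℕ ↦ ((2 : ℝ) ^ (-ε)) ^ n :=
    summable_geometric_of_lt_one (by positivity)
      (Real.rpow_lt_one_of_one_lt_of_neg one_lt_two (by linarith))
  set D : ℝ := A.toReal ^ 2 * (8 * Real.pi ^ 3 * 228 * B * G * 4 ^ ε) with hD
  have hpi := Real.pi_pos
  have hD0 : 0 ≤ D := by positivity
  have hS0 : 0 ≤ ∑' n : ℕ, ((2 : ℝ) ^ (-ε)) ^ n := tsum_nonneg fun n ↦ by positivity
  refine ⟨D * (∑' n : ℕ, ((2 : ℝ) ^ (-ε)) ^ n) + 1, by positivity, fun L Ψ Ψ₁ Ψ₂ hL hΨ ↦ ?_⟩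
  set M : ℝ → ℝ → ℂ := fun u v ↦ Ψ u * ((max (1 - u ^ 2 - v ^ 2) 0 ^ lam : ℝ) : ℂ) with hMdef
  set N : ℕ → ℝ → ℝ → ℂ := fun n u v ↦ Ψ u * annularFactor lam ((2 ^ n)⁻¹) g 0 u v with hNdef
  have hM : IsSquareBounded M := hΨ.isSquareBounded hlam0
  have hδ : ∀ n : ℕ, 0 < ((2 : ℝ) ^ n)⁻¹ := fun n ↦ by positivity
  have hδ1 : ∀ n : ℕ, ((2 : ℝ) ^ n)⁻¹ ≤ 1 := fun n ↦
    inv_le_one_of_one_le₀ (one_le_pow₀ one_le_two)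
  have hNa : ∀ n, IsAnnular ((2 ^ n)⁻¹) _ (N n) := fun n ↦
    (isAnnular_annularFactor (lam := lam) hg hgs hgb (hδ n) (Nat.zero_le 4)).mul_left (hδ n)
      (c := fun u _ ↦ Ψ u) (hΨ.continuous.comp continuous_fst) (fun u hu _ _ ↦ hΨ.bound u hu) le_rfl
  have hN : ∀ n, IsSquareBounded (N n) := fun n ↦ (hNa n).isSquareBounded (hδ n)
  have hfac : ∀ (n : ℕ) (u v : ℝ), annularFactor lam ((2 ^ n)⁻¹) g 0 u v =
      ((((2 ^ n : ℝ)⁻¹) ^ lam * g 0 (2 ^ n * (1 - u ^ 2 - v ^ 2)) : ℝ) : ℂ) := by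
    intro n u v
    rw [annularFactor, pow_zero, mul_one, inv_inv]
  have hreal : ∀ u v : ℝ, HasSum (fun n : ℕ ↦ ((2 ^ n : ℝ)⁻¹) ^ lam *
      g 0 (2 ^ n * (1 - u ^ 2 - v ^ 2))) (max (1 - u ^ 2 - v ^ 2) 0 ^ lam) := fun u v ↦
    hgsum _ (by nlinarith [sq_nonneg u, sq_nonneg v])
  have hsum : ∀ u v, HasSum (fun n ↦ N n u v) (M u v) := by
    intro u v
    simp only [hNdef, hMdef, hfac]
    exact (Complex.hasSum_ofReal.2 (hreal u v)).mul_left (Ψ u)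
  have hnorm : ∀ u v, ∑' n, ‖N n u v‖ₑ = ‖M u v‖ₑ := by
    intro u v
    have e : ∀ x : ℝ, 0 ≤ x → ‖(x : ℂ)‖ₑ = ENNReal.ofReal x := fun x hx ↦ by
      rw [← ofReal_norm, Complex.norm_real, Real.norm_of_nonneg hx]
    have hnn : ∀ n : ℕ, 0 ≤ ((2 ^ n : ℝ)⁻¹) ^ lam * g 0 (2 ^ n * (1 - u ^ 2 - v ^ 2)) := fun n ↦
      mul_nonneg (by positivity) (hg0 _)
    simp only [hNdef, hMdef, hfac, enorm_mul]
    rw [ENNReal.tsum_mul_left, e _ (by positivity), ← (hreal u v).tsum_eq,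
      ENNReal.ofReal_tsum_of_nonneg hnn (hreal u v).summable]
    simp only [e _ (hnn _)]
  have hterm : ∀ n : ℕ, ∫⁻ q : ℝ × ℝ, ∫⁻ p : ℝ × ℝ,
      ‖∫ u, (∫ v, N n u v * Φ (q.2 + v * q.1)) * Φ (p.2 + u * p.1)‖ₑ ≤
      ENNReal.ofReal (D * L ^ (-ε) * ((2 : ℝ) ^ (-ε)) ^ n) := by
    intro n
    set δ : ℝ := ((2 : ℝ) ^ n)⁻¹ with hδdef
    have hδn : 0 < δ := hδ n
    rcases le_or_gt (L * δ) 4 with hLδ | hLδ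
    · refine (hΨ.lintegral_piece_le hP hP' hg hgs hgb hB hL.le hδn (hδ1 n) hLδ).trans ?_
      rw [← hA, ← ENNReal.ofReal_toReal hAfin, ← ENNReal.ofReal_pow ENNReal.toReal_nonneg,
        ← ENNReal.ofReal_mul (by positivity)]
      refine ENNReal.ofReal_le_ofReal ?_
      -- half of the gain `δ ^ (lam - 1)` makes the sum over `n` converge, the other half is
      -- turned into decay in `L` through `δ ≤ 4 / L`
      have h1 : δ ^ lam * δ⁻¹ = δ ^ ε * δ ^ ε := by
        rw [← Real.rpow_neg_one, ← Real.rpow_add hδn, ← Real.rpow_add hδn]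
        congr 1
        rw [hε]
        ring
      have h2 : δ ^ ε ≤ 4 ^ ε * L ^ (-ε) := by
        rw [Real.rpow_neg hL.le, ← div_eq_mul_inv, ← Real.div_rpow (by norm_num) hL.le]
        exact Real.rpow_le_rpow hδn.le (by rwa [le_div_iff₀ hL, mul_comm]) hε0.le
      have h3 : δ ^ ε = ((2 : ℝ) ^ (-ε)) ^ n := by
        rw [hδdef, Real.inv_rpow (by positivity), ← Real.rpow_natCast, ← Real.rpow_mul (by norm_num),
          ← Real.rpow_natCast, ← Real.rpow_mul (by norm_num), ← Real.rpow_neg (by norm_num)]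
        congr 1
        ring
      calc A.toReal ^ 2 * (8 * Real.pi ^ 3 * (228 * (B * (G * δ ^ lam)) * δ⁻¹))
          = A.toReal ^ 2 * (8 * Real.pi ^ 3 * 228 * B * G) * (δ ^ lam * δ⁻¹) := by ring
        _ ≤ A.toReal ^ 2 * (8 * Real.pi ^ 3 * 228 * B * G) * ((4 ^ ε * L ^ (-ε)) * δ ^ ε) := by
          rw [h1]
          gcongr
        _ = _ := by rw [h3, hD]; ring
    · -- the piece vanishes, because `1 - u² - v² ≤ 1 - u² ≤ 2 / L` on the support of `Ψ`
      have h0 : ∀ u v, N n u v = 0 := by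
        intro u v
        by_contra h
        have hu := ((hNa n).mem_square hδn h).1
        have h1 := hΨ.support u hu (left_ne_zero_of_mul h)
        have h2 := ((hNa n).support u v h).1
        have h3 : L * (δ / 2) ≤ L * (1 - u ^ 2) := by
          gcongr
          nlinarith [sq_nonneg v]
        linarith
      simp [h0]
  have hcomp : ∀ w : Plane × Plane, bilinearKernel (fun ξ η ↦
      Ψ (ξ 0 / ξ 1) * ((max (1 - (ξ 0 / ξ 1) ^ 2 - (η 0 / η 1) ^ 2) 0 ^ lam : ℝ) : ℂ) *
          φ (ξ 1) * φ (η 1)) w.1 w.2 =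
      ∫ u, (∫ v, M u v * Φ (w.2 1 + v * w.2 0)) * Φ (w.1 1 + u * w.1 0) := fun w ↦
    bilinearKernel_slope hM hφ hΦ w.1 w.2
  have hmeas : ∀ K : ℝ → ℝ → ℂ, IsSquareBounded K →
      Measurable (Function.uncurry fun p q : ℝ × ℝ ↦
        ‖∫ u, (∫ v, K u v * Φ (q.2 + v * q.1)) * Φ (p.2 + u * p.1)‖ₑ) := by
    intro K hK
    have h1 : Measurable (Function.uncurry fun (s : (ℝ × ℝ) × (ℝ × ℝ)) (u : ℝ) ↦
        (∫ v, K u v * Φ (s.2.2 + v * s.2.1)) * Φ (s.1.2 + u * s.1.1)) :=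
      ((measurable_slope_integral hK Φ).comp
        (measurable_snd.prodMk (measurable_snd.comp measurable_fst))).mul
        (Φ.continuous.measurable.comp (by fun_prop))
    exact h1.stronglyMeasurable.integral_prod_right.measurable.enorm
  simp_rw [hcomp]
  rw [lintegral_plane_prod (H := fun p q ↦
    ‖∫ u, (∫ v, M u v * Φ (q.2 + v * q.1)) * Φ (p.2 + u * p.1)‖ₑ) (hmeas M hM)]
  calc _ ≤ ∫⁻ q : ℝ × ℝ, ∫⁻ p : ℝ × ℝ, ∑' n,
        ‖∫ u, (∫ v, N n u v * Φ (q.2 + v * q.1)) * Φ (p.2 + u * p.1)‖ₑ :=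
        lintegral_mono fun q ↦ lintegral_mono fun p ↦
          enorm_slope_average_le_tsum hM hN hsum hnorm Φ p q
    _ = ∑' n, ∫⁻ q : ℝ × ℝ, ∫⁻ p : ℝ × ℝ,
        ‖∫ u, (∫ v, N n u v * Φ (q.2 + v * q.1)) * Φ (p.2 + u * p.1)‖ₑ := by
      have hm : ∀ n, Measurable fun q : ℝ × ℝ ↦ ∫⁻ p : ℝ × ℝ,
          ‖∫ u, (∫ v, N n u v * Φ (q.2 + v * q.1)) * Φ (p.2 + u * p.1)‖ₑ := fun n ↦
        (hmeas (N n) (hN n)).lintegral_prod_left'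
      rw [← lintegral_tsum fun n ↦ (hm n).aemeasurable]
      refine lintegral_congr fun q ↦ ?_
      exact lintegral_tsum fun n ↦
        ((hmeas (N n) (hN n)).comp measurable_prodMk_right).aemeasurable
    _ ≤ ∑' n : ℕ, ENNReal.ofReal (D * L ^ (-ε) * ((2 : ℝ) ^ (-ε)) ^ n) :=
      ENNReal.tsum_le_tsum hterm
    _ = ENNReal.ofReal (D * L ^ (-ε) * ∑' n : ℕ, ((2 : ℝ) ^ (-ε)) ^ n) := by
      rw [← ENNReal.ofReal_tsum_of_nonneg (fun n ↦ by positivity) (hgeom.mul_left _),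
        tsum_mul_left]
    _ ≤ _ := by
      refine ENNReal.ofReal_le_ofReal ?_
      have : 0 ≤ L ^ (-ε) := by positivity
      nlinarith

end Summation

/-! ### The slope cutoffs of the cone multiplier -/

section Cutoffs

theorem IsSlopeCutoff.mono {B B' L : ℝ} {Ψ Ψ₁ Ψ₂ : ℝ → ℂ} (h : IsSlopeCutoff B L Ψ Ψ₁ Ψ₂)
    (hB : B ≤ B') (hL : 0 ≤ L) : IsSlopeCutoff B' L Ψ Ψ₁ Ψ₂ where
  hasDerivAt := h.hasDerivAt
  hasDerivAt_one := h.hasDerivAt_one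
  continuous_two := h.continuous_two
  bound u hu := (h.bound u hu).trans hB
  bound_one u hu := (h.bound_one u hu).trans (by gcongr)
  bound_two u hu := (h.bound_two u hu).trans (by gcongr)
  support := h.support

theorem ContDiff.hasDerivAt_deriv_deriv {f : ℝ → ℂ} (hf : ContDiff ℝ ∞ f) :
    (∀ t, HasDerivAt f (deriv f t) t) ∧ (∀ t, HasDerivAt (deriv f) (deriv (deriv f) t) t) ∧
      Continuous (deriv (deriv f)) := by
  have h1 : ContDiff ℝ ∞ (deriv f) := (contDiff_infty_iff_deriv.1 hf).2
  have h2 : ContDiff ℝ ∞ (deriv (deriv f)) := (contDiff_infty_iff_deriv.1 h1).2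
  exact ⟨fun t ↦ (hf.differentiable (by simp) t).hasDerivAt,
    fun t ↦ (h1.differentiable (by simp) t).hasDerivAt, h2.continuous⟩

/-- At the coarsest scale every smooth function of the slope is an admissible cutoff. -/
theorem exists_isSlopeCutoff_of_contDiff {Ψ : ℝ → ℂ} (hΨ : ContDiff ℝ ∞ Ψ) :
    ∃ B, 0 ≤ B ∧ ∃ Ψ₁ Ψ₂, IsSlopeCutoff B 2 Ψ Ψ₁ Ψ₂ := by
  obtain ⟨h1, h2, h3⟩ := hΨ.hasDerivAt_deriv_deriv
  have c1 : Continuous (deriv Ψ) := continuous_iff_continuousAt.2 fun u ↦ (h2 u).continuousAt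
  obtain ⟨B₀, hB₀⟩ := (isCompact_Icc (a := (-1 : ℝ)) (b := 1)).exists_bound_of_continuousOn
    hΨ.continuous.continuousOn
  obtain ⟨B₁, hB₁⟩ := (isCompact_Icc (a := (-1 : ℝ)) (b := 1)).exists_bound_of_continuousOn
    c1.continuousOn
  obtain ⟨B₂, hB₂⟩ := (isCompact_Icc (a := (-1 : ℝ)) (b := 1)).exists_bound_of_continuousOn
    h3.continuousOn
  have h0 : (0 : ℝ) ∈ Icc (-1 : ℝ) 1 := by norm_num
  have p0 := (norm_nonneg _).trans (hB₀ 0 h0)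
  have p1 := (norm_nonneg _).trans (hB₁ 0 h0)
  have p2 := (norm_nonneg _).trans (hB₂ 0 h0)
  refine ⟨B₀ + B₁ + B₂, by positivity, deriv Ψ, deriv (deriv Ψ), h1, h2, h3, fun u hu ↦ ?_,
    fun u hu ↦ ?_, fun u hu ↦ ?_, fun u _ _ ↦ ?_⟩
  · linarith [hB₀ u hu]
  · linarith [hB₁ u hu]
  · linarith [hB₂ u hu]
  · nlinarith [sq_nonneg u]

/-- The dyadic cutoffs `ψ(L (1 - u²))` are admissible uniformly in the scale `L`. -/
theorem IsDyadicBump.exists_isSlopeCutoff {ψ : ℝ → ℂ} (hψ : IsDyadicBump ψ) :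
    ∃ B, 0 ≤ B ∧ ∀ L : ℝ, 1 ≤ L → ∃ Ψ₁ Ψ₂,
      IsSlopeCutoff B L (fun u ↦ ψ (L * (1 - u ^ 2))) Ψ₁ Ψ₂ := by
  obtain ⟨h1, h2, h3⟩ := hψ.1.hasDerivAt_deriv_deriv
  have c1 : Continuous (deriv ψ) := continuous_iff_continuousAt.2 fun u ↦ (h2 u).continuousAt
  obtain ⟨B₀, hB₀⟩ := hψ.hasCompactSupport.exists_bound_of_continuous hψ.1.continuous
  obtain ⟨B₁, hB₁⟩ := hψ.hasCompactSupport.deriv.exists_bound_of_continuous c1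
  obtain ⟨B₂, hB₂⟩ := hψ.hasCompactSupport.deriv.deriv.exists_bound_of_continuous h3
  have p0 := (norm_nonneg _).trans (hB₀ 0)
  have p1 := (norm_nonneg _).trans (hB₁ 0)
  have p2 := (norm_nonneg _).trans (hB₂ 0)
  refine ⟨B₀ + 2 * B₁ + 4 * B₂, by positivity, fun L hL ↦
    ⟨fun u ↦ (-2 * L * u : ℝ) * deriv ψ (L * (1 - u ^ 2)),
      fun u ↦ (-2 * L : ℝ) * deriv ψ (L * (1 - u ^ 2)) +
        ((-2 * L * u) ^ 2 : ℝ) * deriv (deriv ψ) (L * (1 - u ^ 2)), ?_⟩⟩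
  have hin : ∀ u : ℝ, HasDerivAt (fun u : ℝ ↦ L * (1 - u ^ 2)) (-2 * L * u) u := fun u ↦ by
    refine ((((hasDerivAt_id u).pow 2).const_sub 1).const_mul L).congr_deriv ?_
    simp
    ring
  have hlin : ∀ u : ℝ, HasDerivAt (fun u : ℝ ↦ ((-2 * L * u : ℝ) : ℂ)) ((-2 * L : ℝ) : ℂ) u :=
    fun u ↦ by simpa using ((hasDerivAt_id u).const_mul (-2 * L)).ofReal_comp
  have hL0 : 0 ≤ L := by linarith
  have habs : ∀ u ∈ Icc (-1 : ℝ) 1, |-2 * L * u| ≤ 2 * L := fun u hu ↦ by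
    rw [abs_mul, abs_mul, abs_of_nonneg hL0]
    norm_num
    nlinarith [abs_le.2 hu, abs_nonneg u]
  refine ⟨fun u ↦ ?_, fun u ↦ ?_, by fun_prop, fun u _ ↦ ?_, fun u hu ↦ ?_, fun u hu ↦ ?_,
    fun u _ h ↦ ?_⟩
  · exact ((h1 _).scomp u (hin u)).congr_deriv (by rw [Complex.real_smul])
  · refine ((hlin u).mul ((h2 _).scomp u (hin u))).congr_deriv ?_
    rw [Complex.real_smul]
    simp only [Function.comp]
    push_cast
    ring
  · linarith [hB₀ (L * (1 - u ^ 2))]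
  · rw [norm_mul, Complex.norm_real, Real.norm_eq_abs]
    calc _ ≤ 2 * L * B₁ := mul_le_mul (habs u hu) (hB₁ _) (norm_nonneg _) (by positivity)
      _ ≤ _ := by nlinarith
  · refine (norm_add_le _ _).trans ?_
    rw [norm_mul, norm_mul, Complex.norm_real, Complex.norm_real, Real.norm_eq_abs,
      Real.norm_eq_abs, abs_pow]
    have e1 : |-2 * L| ≤ 2 * L := by simpa using habs 1 (by norm_num)
    calc _ ≤ 2 * L * B₁ + (2 * L) ^ 2 * B₂ := by
          gcongr
          · exact hB₁ _
          · exact habs u hu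
          · exact hB₂ _
      _ ≤ 2 * L ^ 2 * B₁ + (2 * L) ^ 2 * B₂ := by
          gcongr
          nlinarith
      _ ≤ _ := by nlinarith [mul_nonneg p0 (sq_nonneg L)]
  · by_contra hlt
    exact h (hψ.eq_zero_of_gt (not_le.1 hlt))

/-- For `j = 1` the cutoff `ψ₁(u²)` counts as one at the scale `2 ^ 1`. -/
theorem IsDyadicPartition.exists_isSlopeCutoff {ψ ψ₁ : ℝ → ℂ} (hψ : IsDyadicPartition ψ ψ₁) :
    ∃ B, 0 ≤ B ∧ ∀ j : ℕ, 1 ≤ j → ∃ Ψ₁ Ψ₂, IsSlopeCutoff B (2 ^ j)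
      (fun u ↦ if j = 1 then ψ₁ (u ^ 2) else ψ (2 ^ j * (1 - u ^ 2))) Ψ₁ Ψ₂ := by
  have hs : ContDiff ℝ ∞ fun u : ℝ ↦ ψ₁ (u ^ 2) := by
    rw [← contDiffOn_univ]
    exact hψ.smooth_one.comp (contDiff_id.pow 2).contDiffOn fun u _ ↦ sq_nonneg u
  obtain ⟨B, hB, Ψ₁, Ψ₂, h⟩ := exists_isSlopeCutoff_of_contDiff hs
  obtain ⟨B', hB', h'⟩ := hψ.bump.exists_isSlopeCutoff
  refine ⟨B + B', by positivity, fun j hj ↦ ?_⟩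
  by_cases hj1 : j = 1
  · subst hj1
    simp only [if_true, pow_one]
    exact ⟨Ψ₁, Ψ₂, h.mono (by linarith) (by norm_num)⟩
  · simp only [if_neg hj1]
    obtain ⟨Θ₁, Θ₂, hΘ⟩ := h' (2 ^ j) (one_le_pow₀ one_le_two)
    exact ⟨Θ₁, Θ₂, hΘ.mono (by linarith) (by positivity)⟩

end Cutoffs

theorem proposition2p2
    (φ ψ ψ₁ : ℝ → ℂ) (hφ : IsDyadicBump φ) (hψ : IsDyadicPartition ψ ψ₁)
    (p₁ p₂ p : ℝ≥0∞) (hp₁ : 1 < p₁) (hp₂ : 1 < p₂) (hp : 1 ≤ p)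
    (hpp : p⁻¹ = p₁⁻¹ + p₂⁻¹) (lam : ℝ) (hlam : 1 < lam) :
    ∃ ε : ℝ, 0 < ε ∧ ∃ C : ℝ, 0 < C ∧ ∀ j : ℕ, 1 ≤ j →
      -- on integrable functions the operator is given by the Fourier formula
      (∀ f g : Plane → ℂ, Integrable f volume → Integrable g volume → ∀ x : Plane,
        bilinearOp (conePiece lam φ ψ ψ₁ j) f g x =
          bilinearFourierOp (conePiece lam φ ψ ψ₁ j) f g x) ∧
      -- it is defined on all of `L^{p₁} × L^{p₂}`, with the bound
      (∀ f g : Plane → ℂ, MemLp f p₁ volume → MemLp g p₂ volume →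
        (∀ᵐ x : Plane, Integrable (bilinearIntegrand (conePiece lam φ ψ ψ₁ j) f g x) volume) ∧
        MemLp (bilinearOp (conePiece lam φ ψ ψ₁ j) f g) p volume ∧
        eLpNorm (bilinearOp (conePiece lam φ ψ ψ₁ j) f g) p volume ≤
          ENNReal.ofReal (C * (2 : ℝ) ^ (-(ε * j))) *
            eLpNorm f p₁ volume * eLpNorm g p₂ volume) := by
  obtain ⟨B, hB, hcut⟩ := hψ.exists_isSlopeCutoff
  obtain ⟨C, hC, hker⟩ := exists_lintegral_bilinearKernel_le hφ hlam hB
  refine ⟨(lam - 1) / 2, by linarith, C, hC, fun j hj ↦ ?_⟩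
  obtain ⟨Ψ₁, Ψ₂, hΨ⟩ := hcut j hj
  set Ψ : ℝ → ℂ := fun u ↦ if j = 1 then ψ₁ (u ^ 2) else ψ (2 ^ j * (1 - u ^ 2)) with hΨdef
  have hpiece : conePiece lam φ ψ ψ₁ j = fun ξ η ↦
      Ψ (ξ 0 / ξ 1) * ((max (1 - (ξ 0 / ξ 1) ^ 2 - (η 0 / η 1) ^ 2) 0 ^ lam : ℝ) : ℂ) *
        φ (ξ 1) * φ (η 1) := by
    ext ξ η
    simp only [conePiece, coneMultiplier, hΨdef, div_pow]
    ring
  have hint := (hΨ.isSquareBounded (lam := lam) (by linarith)).integrable_slope hφ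
  have hL := hker (2 ^ j) Ψ Ψ₁ Ψ₂ (by positivity) hΨ
  rw [← hpiece] at hL
  have hexp : ((2 : ℝ) ^ j) ^ (-((lam - 1) / 2)) = 2 ^ (-((lam - 1) / 2 * j)) := by
    rw [← Real.rpow_natCast, ← Real.rpow_mul (by norm_num)]
    congr 1
    ring
  rw [hexp] at hL
  have hint' : Integrable (fun ζ : Plane × Plane ↦ conePiece lam φ ψ ψ₁ j ζ.1 ζ.2) volume := by
    rw [hpiece]
    exact hint
  exact ⟨fun f g hf hg x ↦ bilinearOp_eq_bilinearFourierOp hint' hf hg x,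
    fun f g hf hg ↦ bilinearOp_bound_of_kernel hint' ENNReal.ofReal_ne_top hL hp hpp hf hg⟩
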